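/- Let $N\ge 2$ be an integer and let $1\le p<N$, $1<q<\infty$, $p^*=\frac{Np}{N-p}$ and $1\le r<\min\{p^*,q\}$. Let $K,V:\mathbb R^N\to(0,\infty)$ be Lebesgue measurable functions such that * $K\in L^\alpha_{loc}(\mathbb R^N)$ for some $\alpha\in\left(\frac{\max\{p^*,q\}}{\max\{p^*,q\}-r},\infty\right]$; * $\inf_D V>0$ for each compact set $D\subset\mathbb R^N$; * $K^{\frac{p^*+\beta(p^*-q)}{p^*-r}}\,V^{-\beta}\in L^1(\mathbb R^N)$ for some $\beta\in\left[0,\frac{r}{q-r}\right]$. For $1\le s<\infty$ and a measurable $W>0$, let $L^s_W(\mathbb R^N)$ be the space of all $u\in L^1_{loc}(\mathbb R^N)$ with $\|u\|_{L^s_W}=\left(\int_{\mathbb R^N}|u|^sW\,dx\right)^{1/s}<\infty$, and let $M^{1,p,q}_V(\mathbb R^N)$ be the space of all $u\in L^{p^*}(\mathbb R^N)\cap L^q_V(\mathbb R^N)$ that have a weak gradient with $|\nabla u|\in L^p(\mathbb R^N)$, normed by $\|u\|_{L^q_V}+\||\nabla u|\|_{L^p(\mathbb R^N)}$ (functions that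 agree almost everywhere are identified). Then $M^{1,p,q}_V(\mathbb R^N)\subseteq L^r_K(\mathbb R^N)$, and the inclusion map $M^{1,p,q}_V(\mathbb R^N)\to L^r_K(\mathbb R^N)$ is continuous and compact (bounded sets are mapped to relatively compact sets). -/

import Mathlib

open MeasureTheory
open scoped ENNReal ContDiff

noncomputable section

/-- The critical Sobolev exponent `p* = N p / (N - p)` (used for `p < N`). -/
def sobolevConj (N : ℕ) (p : ℝ) : ℝ := N * p / (N - p)

/-- The measure `W(x) dx` on `ℝ^N`, for a weight `W ≥ 0`. -/
def weightMeasure {N : ℕ} (W : EuclideanSpace ℝ (Fin N) → ℝ) :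
    Measure (EuclideanSpace ℝ (Fin N)) :=
  volume.withDensity fun x => ENNReal.ofReal (W x)

/-- `g` is the weak (distributional) gradient of `u` on `ℝ^N`: both are locally integrable and
`∫ u ∂ᵢφ = - ∫ gᵢ φ` for all test functions `φ ∈ C_c^∞(ℝ^N)` and all `i`. -/
def IsWeakGradient {N : ℕ} (u : EuclideanSpace ℝ (Fin N) → ℝ)
    (g : EuclideanSpace ℝ (Fin N) → EuclideanSpace ℝ (Fin N)) : Prop :=
  LocallyIntegrable u ∧ LocallyIntegrable g ∧
    ∀ φ : EuclideanSpace ℝ (Fin N) → ℝ, ContDiff ℝ ∞ φ → HasCompactSupport φ →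
      ∀ i : Fin N, ∫ x, u x * fderiv ℝ φ x (EuclideanSpace.single i 1) = -∫ x, g x i * φ x

theorem weightMeasure_ac {N : ℕ} (W : EuclideanSpace ℝ (Fin N) → ℝ) :
    weightMeasure W ≪ volume :=
  withDensity_absolutelyContinuous _ _

theorem aestronglyMeasurable_weight {N : ℕ} (W : EuclideanSpace ℝ (Fin N) → ℝ)
    (u : EuclideanSpace ℝ (Fin N) →ₘ[volume] ℝ) : AEStronglyMeasurable u (weightMeasure W) :=
  u.aestronglyMeasurable.mono_ac (weightMeasure_ac W)

theorem locallyIntegrable_congr {N : ℕ} {F : Type*} [NormedAddCommGroup F]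
    {u v : EuclideanSpace ℝ (Fin N) → F} (h : u =ᵐ[volume] v) (hu : LocallyIntegrable u) :
    LocallyIntegrable v :=
  fun x => by
    obtain ⟨s, hs, hi⟩ := hu x
    exact ⟨s, hs, hi.congr (ae_restrict_of_ae h)⟩

/-- The weighted Lebesgue space `L^s_W(ℝ^N)`: the (classes of a.e. equal) functions
`u ∈ L¹_loc(ℝ^N)` with `∫ |u|^s W dx < ∞`. -/
def weightedLp {N : ℕ} (s : ℝ) (W : EuclideanSpace ℝ (Fin N) → ℝ) :
    Submodule ℝ (EuclideanSpace ℝ (Fin N) →ₘ[volume] ℝ) where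
  carrier := {u | LocallyIntegrable u ∧ MemLp u (ENNReal.ofReal s) (weightMeasure W)}
  zero_mem' := by
    refine ⟨locallyIntegrable_congr AEEqFun.coeFn_zero.symm (locallyIntegrable_zero), ?_⟩
    exact (memLp_congr_ae ((weightMeasure_ac W).ae_le AEEqFun.coeFn_zero)).2 MemLp.zero
  add_mem' := by
    intro u v hu hv
    refine ⟨locallyIntegrable_congr (AEEqFun.coeFn_add u v).symm (hu.1.add hv.1), ?_⟩
    exact (memLp_congr_ae ((weightMeasure_ac W).ae_le (AEEqFun.coeFn_add u v))).2 (hu.2.add hv.2)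
  smul_mem' := by
    intro c u hu
    refine ⟨locallyIntegrable_congr (AEEqFun.coeFn_smul c u).symm (hu.1.smul c), ?_⟩
    exact (memLp_congr_ae ((weightMeasure_ac W).ae_le (AEEqFun.coeFn_smul c u))).2
      (hu.2.const_smul c)

/-- `‖u‖ = (∫ |u|^s W dx)^(1/s)` on `L^s_W(ℝ^N)`. -/
instance weightedLp.instNorm {N : ℕ} (s : ℝ) (W : EuclideanSpace ℝ (Fin N) → ℝ) :
    Norm (weightedLp s W) :=
  ⟨fun u => (eLpNorm (u : EuclideanSpace ℝ (Fin N) →ₘ[volume] ℝ) (ENNReal.ofReal s)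
    (weightMeasure W)).toReal⟩

theorem eLpNorm_weight_add_le {N : ℕ} {s : ℝ} (hs : 1 ≤ s) (W : EuclideanSpace ℝ (Fin N) → ℝ)
    {u v : EuclideanSpace ℝ (Fin N) →ₘ[volume] ℝ}
    (hu : u ∈ weightedLp s W) (hv : v ∈ weightedLp s W) :
    (eLpNorm (u + v : EuclideanSpace ℝ (Fin N) →ₘ[volume] ℝ) (ENNReal.ofReal s)
      (weightMeasure W)).toReal ≤
    (eLpNorm u (ENNReal.ofReal s) (weightMeasure W)).toReal +
      (eLpNorm v (ENNReal.ofReal s) (weightMeasure W)).toReal := by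
  rw [← ENNReal.toReal_add hu.2.2.ne hv.2.2.ne,
    eLpNorm_congr_ae ((weightMeasure_ac W).ae_le (AEEqFun.coeFn_add u v))]
  exact ENNReal.toReal_mono (ENNReal.add_ne_top.2 ⟨hu.2.2.ne, hv.2.2.ne⟩)
    (eLpNorm_add_le hu.2.1 hv.2.1 (by simpa using hs))

theorem eLpNorm_weight_smul {N : ℕ} (s : ℝ) (W : EuclideanSpace ℝ (Fin N) → ℝ) (c : ℝ)
    (u : EuclideanSpace ℝ (Fin N) →ₘ[volume] ℝ) :
    (eLpNorm (c • u : EuclideanSpace ℝ (Fin N) →ₘ[volume] ℝ) (ENNReal.ofReal s)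
      (weightMeasure W)).toReal =
    ‖c‖ * (eLpNorm u (ENNReal.ofReal s) (weightMeasure W)).toReal := by
  rw [eLpNorm_congr_ae ((weightMeasure_ac W).ae_le (AEEqFun.coeFn_smul c u)),
    eLpNorm_const_smul, ENNReal.toReal_mul, toReal_enorm]

theorem weightedLp.core {N : ℕ} {s : ℝ} (hs : 1 ≤ s) (W : EuclideanSpace ℝ (Fin N) → ℝ) :
    SeminormedSpace.Core ℝ (weightedLp s W) where
  norm_nonneg _ := ENNReal.toReal_nonneg
  norm_smul c u := eLpNorm_weight_smul s W c u
  norm_triangle u v := eLpNorm_weight_add_le hs W u.2 v.2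

/-- For an arbitrary weight this is a seminorm; it is a norm as soon as `W > 0` a.e. -/
instance weightedLp.instSeminormedAddCommGroup {N : ℕ} (s : ℝ) [hs : Fact (1 ≤ s)]
    (W : EuclideanSpace ℝ (Fin N) → ℝ) : SeminormedAddCommGroup (weightedLp s W) :=
  SeminormedAddCommGroup.ofCore (weightedLp.core hs.out W)

instance weightedLp.instNormedSpace {N : ℕ} (s : ℝ) [hs : Fact (1 ≤ s)]
    (W : EuclideanSpace ℝ (Fin N) → ℝ) : NormedSpace ℝ (weightedLp s W) where
  norm_smul_le c u := ((weightedLp.core hs.out W).norm_smul c u).le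

theorem IsWeakGradient.congr {N : ℕ} {u u' : EuclideanSpace ℝ (Fin N) → ℝ}
    {g : EuclideanSpace ℝ (Fin N) → EuclideanSpace ℝ (Fin N)}
    (h : IsWeakGradient u g) (hu : u =ᵐ[volume] u') : IsWeakGradient u' g := by
  refine ⟨locallyIntegrable_congr hu h.1, h.2.1, fun φ hφ hc i => ?_⟩
  rw [← h.2.2 φ hφ hc i]
  exact integral_congr_ae (by filter_upwards [hu] with x hx; rw [hx])

theorem integrable_mul_test {N : ℕ} {f ψ : EuclideanSpace ℝ (Fin N) → ℝ}
    (hf : LocallyIntegrable f) (hψ : Continuous ψ) (hc : HasCompactSupport ψ) :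
    Integrable fun x => f x * ψ x := by
  simpa [mul_comm] using hf.integrable_smul_left_of_hasCompactSupport hψ hc

theorem locallyIntegrable_coord {N : ℕ}
    {g : EuclideanSpace ℝ (Fin N) → EuclideanSpace ℝ (Fin N)}
    (hg : LocallyIntegrable g) (i : Fin N) : LocallyIntegrable fun x => g x i := by
  intro x
  obtain ⟨s, hs, hi⟩ := hg x
  exact ⟨s, hs, (EuclideanSpace.proj (𝕜 := ℝ) i).integrable_comp hi⟩

theorem integrable_mul_fderiv {N : ℕ} {f φ : EuclideanSpace ℝ (Fin N) → ℝ}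
    (hf : LocallyIntegrable f) (hφ : ContDiff ℝ ∞ φ) (hc : HasCompactSupport φ)
    (v : EuclideanSpace ℝ (Fin N)) : Integrable fun x => f x * fderiv ℝ φ x v :=
  integrable_mul_test hf ((hφ.continuous_fderiv (by simp)).clm_apply continuous_const)
    (hc.fderiv_apply ℝ v)

theorem IsWeakGradient.add {N : ℕ} {u v : EuclideanSpace ℝ (Fin N) → ℝ}
    {g h : EuclideanSpace ℝ (Fin N) → EuclideanSpace ℝ (Fin N)}
    (hu : IsWeakGradient u g) (hv : IsWeakGradient v h) : IsWeakGradient (u + v) (g + h) := by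
  refine ⟨hu.1.add hv.1, hu.2.1.add hv.2.1, fun φ hφ hc i => ?_⟩
  simp only [Pi.add_apply, PiLp.add_apply, add_mul]
  rw [integral_add (integrable_mul_fderiv hu.1 hφ hc _) (integrable_mul_fderiv hv.1 hφ hc _),
    integral_add (integrable_mul_test (locallyIntegrable_coord hu.2.1 i) hφ.continuous hc)
      (integrable_mul_test (locallyIntegrable_coord hv.2.1 i) hφ.continuous hc),
    hu.2.2 φ hφ hc i, hv.2.2 φ hφ hc i]
  ring

theorem IsWeakGradient.smul {N : ℕ} {u : EuclideanSpace ℝ (Fin N) → ℝ}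
    {g : EuclideanSpace ℝ (Fin N) → EuclideanSpace ℝ (Fin N)}
    (hu : IsWeakGradient u g) (c : ℝ) : IsWeakGradient (c • u) (c • g) := by
  refine ⟨hu.1.smul c, hu.2.1.smul c, fun φ hφ hc i => ?_⟩
  simp only [Pi.smul_apply, PiLp.smul_apply, smul_eq_mul, mul_assoc]
  rw [integral_const_mul, integral_const_mul, hu.2.2 φ hφ hc i]
  ring

/-- Weak gradients are unique up to null sets. -/
theorem IsWeakGradient.unique {N : ℕ} {u : EuclideanSpace ℝ (Fin N) → ℝ}
    {g h : EuclideanSpace ℝ (Fin N) → EuclideanSpace ℝ (Fin N)}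
    (hg : IsWeakGradient u g) (hh : IsWeakGradient u h) : g =ᵐ[volume] h := by
  have key : ∀ i : Fin N, ∀ᵐ x, g x i = h x i := fun i => by
    refine ae_eq_of_integral_contDiff_smul_eq (locallyIntegrable_coord hg.2.1 i)
      (locallyIntegrable_coord hh.2.1 i) fun φ hφ hc => ?_
    have := (hg.2.2 φ hφ hc i).symm.trans (hh.2.2 φ hφ hc i)
    simpa [mul_comm] using this
  filter_upwards [ae_all_iff.2 key] with x hx
  ext i
  exact hx i

/-- The space `D^{1,p}(ℝ^N)`: the functions `u ∈ L^{p*}(ℝ^N)` which have a weak gradient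
with `|∇u| ∈ L^p(ℝ^N)`. -/
def sobolevD {N : ℕ} (p : ℝ) : Submodule ℝ (EuclideanSpace ℝ (Fin N) →ₘ[volume] ℝ) where
  carrier := {u | MemLp u (ENNReal.ofReal (sobolevConj N p)) volume ∧
    ∃ g, IsWeakGradient u g ∧ MemLp g (ENNReal.ofReal p) volume}
  zero_mem' := by
    refine ⟨(memLp_congr_ae AEEqFun.coeFn_zero).2 MemLp.zero, 0, ?_, MemLp.zero⟩
    refine IsWeakGradient.congr (u := 0) ⟨locallyIntegrable_zero, locallyIntegrable_zero, ?_⟩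
      AEEqFun.coeFn_zero.symm
    simp
  add_mem' := by
    rintro u v ⟨hu, g, hg, hgp⟩ ⟨hv, h, hh, hhp⟩
    exact ⟨(memLp_congr_ae (AEEqFun.coeFn_add u v)).2 (hu.add hv), g + h,
      (hg.add hh).congr (AEEqFun.coeFn_add u v).symm, hgp.add hhp⟩
  smul_mem' := by
    rintro c u ⟨hu, g, hg, hgp⟩
    exact ⟨(memLp_congr_ae (AEEqFun.coeFn_smul c u)).2 (hu.const_smul c), c • g,
      (hg.smul c).congr (AEEqFun.coeFn_smul c u).symm, hgp.const_smul c⟩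

/-- The space `M^{1,p,q}_V(ℝ^N)`: the functions `u ∈ D^{1,p}(ℝ^N)` with `u ∈ L^q_V(ℝ^N)`. -/
def sobolevM {N : ℕ} (p q : ℝ) (V : EuclideanSpace ℝ (Fin N) → ℝ) :
    Submodule ℝ (EuclideanSpace ℝ (Fin N) →ₘ[volume] ℝ) :=
  sobolevD p ⊓ weightedLp q V

/-- The weak gradient of `u ∈ M^{1,p,q}_V(ℝ^N)` (a representative; it is unique a.e.). -/
def sobolevM.grad {N : ℕ} {p q : ℝ} {V : EuclideanSpace ℝ (Fin N) → ℝ} (u : sobolevM p q V) :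
    EuclideanSpace ℝ (Fin N) → EuclideanSpace ℝ (Fin N) :=
  u.2.1.2.choose

theorem sobolevM.isWeakGradient_grad {N : ℕ} {p q : ℝ} {V : EuclideanSpace ℝ (Fin N) → ℝ}
    (u : sobolevM p q V) :
    IsWeakGradient (u : EuclideanSpace ℝ (Fin N) →ₘ[volume] ℝ) (sobolevM.grad u) :=
  u.2.1.2.choose_spec.1

theorem sobolevM.memLp_grad {N : ℕ} {p q : ℝ} {V : EuclideanSpace ℝ (Fin N) → ℝ}
    (u : sobolevM p q V) : MemLp (sobolevM.grad u) (ENNReal.ofReal p) volume :=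
  u.2.1.2.choose_spec.2

theorem sobolevM.grad_add {N : ℕ} {p q : ℝ} {V : EuclideanSpace ℝ (Fin N) → ℝ}
    (u v : sobolevM p q V) :
    sobolevM.grad (u + v) =ᵐ[volume] sobolevM.grad u + sobolevM.grad v :=
  (sobolevM.isWeakGradient_grad (u + v)).unique
    (((sobolevM.isWeakGradient_grad u).add (sobolevM.isWeakGradient_grad v)).congr
      (AEEqFun.coeFn_add _ _).symm)

theorem sobolevM.grad_smul {N : ℕ} {p q : ℝ} {V : EuclideanSpace ℝ (Fin N) → ℝ}
    (c : ℝ) (u : sobolevM p q V) :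
    sobolevM.grad (c • u) =ᵐ[volume] c • sobolevM.grad u :=
  (sobolevM.isWeakGradient_grad (c • u)).unique
    (((sobolevM.isWeakGradient_grad u).smul c).congr (AEEqFun.coeFn_smul _ _).symm)

/-- `‖u‖ = ‖u‖_{L^q_V} + ‖ |∇u| ‖_{L^p}` on `M^{1,p,q}_V(ℝ^N)`. -/
instance sobolevM.instNorm {N : ℕ} (p q : ℝ) (V : EuclideanSpace ℝ (Fin N) → ℝ) :
    Norm (sobolevM p q V) :=
  ⟨fun u => (eLpNorm (u : EuclideanSpace ℝ (Fin N) →ₘ[volume] ℝ) (ENNReal.ofReal q)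
    (weightMeasure V)).toReal + (eLpNorm (sobolevM.grad u) (ENNReal.ofReal p) volume).toReal⟩

theorem sobolevM.core {N : ℕ} {p q : ℝ} (hp : 1 ≤ p) (hq : 1 ≤ q)
    (V : EuclideanSpace ℝ (Fin N) → ℝ) : SeminormedSpace.Core ℝ (sobolevM p q V) where
  norm_nonneg _ := add_nonneg ENNReal.toReal_nonneg ENNReal.toReal_nonneg
  norm_smul c u := by
    have h1 := eLpNorm_weight_smul q V c (u : EuclideanSpace ℝ (Fin N) →ₘ[volume] ℝ)
    have h2 : (eLpNorm (sobolevM.grad (c • u)) (ENNReal.ofReal p) volume).toReal =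
        ‖c‖ * (eLpNorm (sobolevM.grad u) (ENNReal.ofReal p) volume).toReal := by
      rw [eLpNorm_congr_ae (sobolevM.grad_smul c u), eLpNorm_const_smul, ENNReal.toReal_mul,
        toReal_enorm]
    exact (congrArg₂ (· + ·) h1 h2).trans (mul_add _ _ _).symm
  norm_triangle u v := by
    have h1 := eLpNorm_weight_add_le hq V u.2.2 v.2.2
    have h2 : (eLpNorm (sobolevM.grad (u + v)) (ENNReal.ofReal p) volume).toReal ≤
        (eLpNorm (sobolevM.grad u) (ENNReal.ofReal p) volume).toReal +
          (eLpNorm (sobolevM.grad v) (ENNReal.ofReal p) volume).toReal := by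
      have hu := sobolevM.memLp_grad u
      have hv := sobolevM.memLp_grad v
      rw [eLpNorm_congr_ae (sobolevM.grad_add u v), ← ENNReal.toReal_add hu.2.ne hv.2.ne]
      exact ENNReal.toReal_mono (ENNReal.add_ne_top.2 ⟨hu.2.ne, hv.2.ne⟩)
        (eLpNorm_add_le hu.1 hv.1 (by simpa using hp))
    exact (add_le_add h1 h2).trans_eq (add_add_add_comm _ _ _ _)

/-- For an arbitrary weight this is a seminorm; it is a norm as soon as `V > 0` a.e. -/
instance sobolevM.instSeminormedAddCommGroup {N : ℕ} (p q : ℝ) [hp : Fact (1 ≤ p)]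
    [hq : Fact (1 ≤ q)] (V : EuclideanSpace ℝ (Fin N) → ℝ) :
    SeminormedAddCommGroup (sobolevM p q V) :=
  SeminormedAddCommGroup.ofCore (sobolevM.core hp.out hq.out V)

instance sobolevM.instNormedSpace {N : ℕ} (p q : ℝ) [hp : Fact (1 ≤ p)] [hq : Fact (1 ≤ q)]
    (V : EuclideanSpace ℝ (Fin N) → ℝ) : NormedSpace ℝ (sobolevM p q V) where
  norm_smul_le c u := ((sobolevM.core hp.out hq.out V).norm_smul c u).le

end

open Filter Set Metric
open ContinuousLinearMap (lsmul)
open scoped Convolution Topology NNReal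

/-! The integral of K|u|^r is controlled in two ways. Globally, K|u|^r is a product of powers of K^A
V^(-β), |u|^(p*) and V|u|^q, and Hölder's inequality bounds its integral over any set S by a
positive power of the integral of K^A V^(-β) over S, uniformly on bounded sets of M
(`sobolevM.exists_setLIntegral_weight_le`). Taking S to be the whole space gives the embedding;
taking S to be the exterior of a large ball gives uniformly small tails. The condition β ≤ r/(q-r)
is what keeps the Hölder exponents nonnegative.

On a ball, V is bounded below, so u is bounded in L^m with m = max(p*, q). The integrability of K
then allows Hölder between L^1 and L^m with a positive power of the L^1 norm
(`exists_setLIntegral_weight_mul_rpow_le`). Smallness in L^1 comes from Rellich–Kondrachov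
(`exists_finite_net_setLIntegral_ball`). Together with the tails, this makes the image of the unit
ball totally bounded in L^r_K.

Total boundedness alone does not give relative compactness, since L^r_K is restricted to locally
integrable functions and K is not assumed bounded below, so completeness is not available for the
whole space. Sobolev's inequality (`IsWeakGradient.eLpNorm_sobolevConj_le`) places the image in a
bounded subset of L^(p*), and such subsets are complete for the L^r_K norm by Fatou
(`weightedLp.isComplete_setOf_eLpNorm_le`). -/

/-! ### Mollification and the product rule for weak gradients -/

/-- The derivative of a mollification is the mollification of the weak gradient. -/
theorem IsWeakGradient.hasFDerivAt_convolution {N : ℕ} {u : EuclideanSpace ℝ (Fin N) → ℝ}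
    {g : EuclideanSpace ℝ (Fin N) → EuclideanSpace ℝ (Fin N)} (h : IsWeakGradient u g)
    {φ : EuclideanSpace ℝ (Fin N) → ℝ} (hφ : ContDiff ℝ ∞ φ) (hc : HasCompactSupport φ)
    (x : EuclideanSpace ℝ (Fin N)) :
    HasFDerivAt (φ ⋆[lsmul ℝ ℝ, volume] u) (innerSL ℝ ((φ ⋆[lsmul ℝ ℝ, volume] g) x)) x := by
  have hφ1 : ContDiff ℝ 1 φ := hφ.of_le (by simp)
  have h1 := hc.hasFDerivAt_convolution_left (lsmul ℝ ℝ) hφ1 h.1 x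
  refine h1.congr_fderiv (Eq.symm ?_)
  have hint : Integrable (fun t => φ (x - t) • g t) :=
    (hc.convolutionExists_left (lsmul ℝ ℝ) hφ.continuous h.2.1 x).integrable_swap
  have hint' : Integrable (fun t => ((lsmul ℝ ℝ).precompL (EuclideanSpace ℝ (Fin N)))
      (fderiv ℝ φ (x - t)) (u t)) :=
    ((hc.fderiv ℝ).convolutionExists_left _ (hφ.continuous_fderiv (by simp)) h.1 x).integrable_swap
  rw [convolution_lsmul_swap, convolution_eq_swap]
  refine ContinuousLinearMap.coe_injective
    ((EuclideanSpace.basisFun (Fin N) ℝ).toBasis.ext fun i => ?_)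
  simp only [OrthonormalBasis.coe_toBasis, EuclideanSpace.basisFun_apply,
    ContinuousLinearMap.coe_coe, innerSL_apply_apply]
  rw [ContinuousLinearMap.integral_apply hint']
  have hψ : ContDiff ℝ ∞ fun t => φ (x - t) := hφ.comp (contDiff_const.sub contDiff_id)
  have hψc : HasCompactSupport fun t => φ (x - t) :=
    hc.comp_homeomorph (Homeomorph.subLeft x)
  -- The reflected kernel t ↦ φ(x - t) is itself a test function; the sign from the reflection
  -- cancels the sign in the definition of the weak gradient.
  have key := h.2.2 _ hψ hψc i
  have hd : ∀ t, fderiv ℝ (fun t => φ (x - t)) t (EuclideanSpace.single i 1) =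
      - fderiv ℝ φ (x - t) (EuclideanSpace.single i 1) := by
    intro t
    have : HasFDerivAt (fun t => φ (x - t)) ((fderiv ℝ φ (x - t)).comp
        (-ContinuousLinearMap.id ℝ _)) t :=
      ((hφ1.differentiable one_ne_zero) (x - t)).hasFDerivAt.comp t
        ((hasFDerivAt_id t).const_sub x)
    rw [this.fderiv]; simp
  simp only [hd, mul_neg, integral_neg, neg_inj] at key
  have h3 := (EuclideanSpace.proj (𝕜 := ℝ) i).integral_comp_comm hint
  rw [EuclideanSpace.inner_single_right]
  simp only [PiLp.proj_apply, PiLp.smul_apply, smul_eq_mul] at h3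
  simp only [conj_trivial, one_mul, ← h3]
  rw [show (∫ t, φ (x - t) * g t i) = ∫ t, g t i * φ (x - t) from by simp only [mul_comm], ← key]
  simp [ContinuousLinearMap.precompL_apply, mul_comm]

theorem lintegral_ofReal_eq_one {α : Type*} [MeasurableSpace α] {μ : Measure α} {φ : α → ℝ}
    (h0 : ∀ x, 0 ≤ φ x) (h1 : ∫ x, φ x ∂μ = 1) : ∫⁻ x, ENNReal.ofReal (φ x) ∂μ = 1 := by
  rw [← ofReal_integral_eq_lintegral_ofReal (integrable_of_integral_eq_one h1)
    (Eventually.of_forall h0), h1, ENNReal.ofReal_one]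

/-- Convolution with a probability density does not increase `L^p` norms. -/
theorem eLpNorm_convolution_le {N : ℕ} {F : Type*} [NormedAddCommGroup F] [NormedSpace ℝ F]
    {φ : EuclideanSpace ℝ (Fin N) → ℝ} (hφ : Continuous φ) (h0 : ∀ x, 0 ≤ φ x)
    (h1 : ∫ x, φ x = 1) {g : EuclideanSpace ℝ (Fin N) → F} (hg : AEStronglyMeasurable g volume)
    {p : ℝ} (hp : 1 ≤ p) :
    eLpNorm (φ ⋆[lsmul ℝ ℝ, volume] g) (ENNReal.ofReal p) volume ≤
      eLpNorm g (ENNReal.ofReal p) volume := by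
  set ν : Measure (EuclideanSpace ℝ (Fin N)) :=
    volume.withDensity fun x => ENNReal.ofReal (φ x) with hν
  have hφm : Measurable fun x => ENNReal.ofReal (φ x) := hφ.measurable.ennreal_ofReal
  have : IsProbabilityMeasure ν := ⟨by
    rw [hν, withDensity_apply _ MeasurableSet.univ, Measure.restrict_univ,
      lintegral_ofReal_eq_one h0 h1]⟩
  have hνac : ν ≪ volume := withDensity_absolutelyContinuous _ _
  have hp0 : 0 < p := by linarith
  have hpe : ENNReal.ofReal p ≠ 0 := by simpa using hp0
  have hm' : ∀ x, AEStronglyMeasurable (fun s => g (x - s)) volume := fun x =>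
    hg.comp_quasiMeasurePreserving (quasiMeasurePreserving_sub_left volume x)
  have hm : ∀ x, AEStronglyMeasurable (fun s => g (x - s)) ν := fun x => (hm' x).mono_ac hνac
  rw [eLpNorm_eq_lintegral_rpow_enorm_toReal hpe ENNReal.ofReal_ne_top,
    eLpNorm_eq_lintegral_rpow_enorm_toReal hpe ENNReal.ofReal_ne_top, ENNReal.toReal_ofReal hp0.le]
  refine ENNReal.rpow_le_rpow ?_ (by positivity)
  have hb : ∀ x, ‖(φ ⋆[lsmul ℝ ℝ, volume] g) x‖ₑ ^ p ≤ ∫⁻ s, ‖g (x - s)‖ₑ ^ p ∂ν := by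
    intro x
    have e1 : ‖(φ ⋆[lsmul ℝ ℝ, volume] g) x‖ₑ ≤ eLpNorm (fun s => g (x - s)) 1 ν := by
      rw [convolution_lsmul, eLpNorm_one_eq_lintegral_enorm,
        hν,
        lintegral_withDensity_eq_lintegral_mul₀ hφm.aemeasurable (hm' x).enorm]
      refine (enorm_integral_le_lintegral_enorm _).trans_eq ?_
      refine lintegral_congr fun s => ?_
      simp [enorm_smul, Real.enorm_of_nonneg (h0 s)]
    -- Jensen's inequality, in the form of monotonicity of L^p norms in p for the probability
    -- measure φ ds. Tonelli and translation invariance then finish.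
    have e2 : eLpNorm (fun s => g (x - s)) 1 ν ≤
        eLpNorm (fun s => g (x - s)) (ENNReal.ofReal p) ν :=
      eLpNorm_le_eLpNorm_of_exponent_le (by simpa using hp) (hm x)
    have e3 := e1.trans e2
    rw [eLpNorm_eq_lintegral_rpow_enorm_toReal hpe ENNReal.ofReal_ne_top,
      ENNReal.toReal_ofReal hp0.le, one_div] at e3
    exact (ENNReal.le_rpow_inv_iff hp0).1 e3
  calc ∫⁻ x, ‖(φ ⋆[lsmul ℝ ℝ, volume] g) x‖ₑ ^ p ≤ ∫⁻ x, (∫⁻ s, ‖g (x - s)‖ₑ ^ p ∂ν) :=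
        lintegral_mono hb
    _ = ∫⁻ s, (∫⁻ x, ‖g (x - s)‖ₑ ^ p) ∂ν := by
        refine lintegral_lintegral_swap ?_
        have : AEStronglyMeasurable (fun z : EuclideanSpace ℝ (Fin N) × EuclideanSpace ℝ (Fin N) =>
            g (z.1 - z.2)) (volume.prod ν) :=
          (hg.comp_quasiMeasurePreserving
            (quasiMeasurePreserving_sub volume volume)).mono_ac
              (Measure.AbsolutelyContinuous.rfl.prod hνac)
        exact this.enorm.pow_const p
    _ = ∫⁻ s, (∫⁻ x, ‖g x‖ₑ ^ p) ∂ν := by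
        refine lintegral_congr fun s => ?_
        exact lintegral_sub_right_eq_self (fun x => ‖g x‖ₑ ^ p) s
    _ = ∫⁻ x, ‖g x‖ₑ ^ p := by simp

/-- A sequence of smooth bump functions shrinking to the origin. -/
noncomputable def mollifier (N n : ℕ) : ContDiffBump (0 : EuclideanSpace ℝ (Fin N)) where
  rIn := 1 / (2 * ((n : ℝ) + 1))
  rOut := 1 / ((n : ℝ) + 1)
  rIn_pos := by positivity
  rIn_lt_rOut := by
    apply one_div_lt_one_div_of_lt <;> nlinarith [(Nat.cast_nonneg n : (0 : ℝ) ≤ n)]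

/-- Lebesgue differentiation. It applies because the inner and outer radii of the bumps keep the
fixed ratio 2, which is the constant `K := 2`. -/
theorem ae_tendsto_convolution_mollifier {N : ℕ} {F : Type*} [NormedAddCommGroup F]
    [NormedSpace ℝ F] [CompleteSpace F] {u : EuclideanSpace ℝ (Fin N) → F}
    (hu : LocallyIntegrable u) :
    ∀ᵐ x, Tendsto (fun n => ((mollifier N n).normed volume ⋆[lsmul ℝ ℝ, volume] u) x) atTop
      (𝓝 (u x)) := by
  refine ContDiffBump.ae_convolution_tendsto_right_of_locallyIntegrable (K := 2)
    tendsto_one_div_add_atTop_nhds_zero_nat (Eventually.of_forall fun n => ?_) hu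
  simp only [mollifier]
  rw [one_div, one_div, mul_inv]
  linarith

theorem continuous_convolution_of_locallyIntegrable {N : ℕ} {F : Type*} [NormedAddCommGroup F]
    [NormedSpace ℝ F] {φ : EuclideanSpace ℝ (Fin N) → ℝ} (hφ : Continuous φ)
    (hc : HasCompactSupport φ) {u : EuclideanSpace ℝ (Fin N) → F} (hu : LocallyIntegrable u) :
    Continuous (φ ⋆[lsmul ℝ ℝ, volume] u) :=
  hc.continuous_convolution_left _ hφ hu

/-- The function χφ is an admissible test function for u, because compact support of φ alone
suffices; the Leibniz rule for χφ gives the product rule for χu. -/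
theorem IsWeakGradient.mul_contDiff {N : ℕ} {u : EuclideanSpace ℝ (Fin N) → ℝ}
    {g : EuclideanSpace ℝ (Fin N) → EuclideanSpace ℝ (Fin N)} (h : IsWeakGradient u g)
    {χ : EuclideanSpace ℝ (Fin N) → ℝ} (hχ : ContDiff ℝ ∞ χ) :
    IsWeakGradient (fun x => χ x * u x) (fun x => χ x • g x + u x • gradient χ x) := by
  have hχ1 : Differentiable ℝ χ := hχ.differentiable (by simp)
  have hgr : Continuous (gradient χ) :=
    (InnerProductSpace.toDual ℝ _).symm.continuous.comp (hχ.continuous_fderiv (by simp))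
  have h1 : LocallyIntegrable (fun x => χ x * u x) := h.1.continuous_mul hχ.continuous
  have h2 : LocallyIntegrable (fun x => χ x • g x) := h.2.1.continuous_smul hχ.continuous
  have h3 : LocallyIntegrable (fun x => u x • gradient χ x) := h.1.smul_continuous hgr
  refine ⟨h1, h2.add h3, fun φ hφ hc i => ?_⟩
  have hφ1 : Differentiable ℝ φ := hφ.differentiable (by simp)
  have key := h.2.2 (fun x => χ x * φ x) (hχ.mul hφ) hc.mul_left i
  have hd : ∀ x, fderiv ℝ (fun x => χ x * φ x) x (EuclideanSpace.single i 1) =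
      χ x * fderiv ℝ φ x (EuclideanSpace.single i 1) + φ x * gradient χ x i := by
    intro x
    rw [fderiv_fun_mul (hχ1 x) (hφ1 x)]
    have : gradient χ x i = fderiv ℝ χ x (EuclideanSpace.single i 1) := by
      rw [← InnerProductSpace.toDual_symm_apply (𝕜 := ℝ), EuclideanSpace.inner_single_right]
      simp [gradient]
    simp [this]
  simp only [hd, mul_add] at key
  have i1 : Integrable fun x => u x * (χ x * fderiv ℝ φ x (EuclideanSpace.single i 1)) := by
    have := integrable_mul_fderiv h1 hφ hc (EuclideanSpace.single i 1)
    refine this.congr (Eventually.of_forall fun x => ?_)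
    simp only; ring
  have i2 : Integrable fun x => u x * (φ x * gradient χ x i) := by
    have := integrable_mul_test (locallyIntegrable_coord h3 i) hφ.continuous hc
    refine this.congr (Eventually.of_forall fun x => ?_)
    simp only [PiLp.smul_apply, smul_eq_mul]; ring
  have i3 : Integrable fun x => g x i * (χ x * φ x) :=
    integrable_mul_test (locallyIntegrable_coord h.2.1 i) (hχ.continuous.mul hφ.continuous)
      hc.mul_left
  rw [integral_add i1 i2] at key
  have e1 : ∫ x, χ x * u x * fderiv ℝ φ x (EuclideanSpace.single i 1) =
      ∫ x, u x * (χ x * fderiv ℝ φ x (EuclideanSpace.single i 1)) :=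
    integral_congr_ae (Eventually.of_forall fun x => by simp only; ring)
  have e2 : ∫ x, (χ x • g x + u x • gradient χ x) i * φ x =
      (∫ x, g x i * (χ x * φ x)) + ∫ x, u x * (φ x * gradient χ x i) := by
    rw [← integral_add i3 i2]
    refine integral_congr_ae (Eventually.of_forall fun x => ?_)
    simp only [PiLp.add_apply, PiLp.smul_apply, smul_eq_mul]; ring
  rw [e1, e2]
  linarith

/-! ### The Sobolev inequality in D^{1,p} -/

theorem sobolevConj_inv {N : ℕ} {p : ℝ} (hp : 1 ≤ p) (hpN : p < N) :
    (sobolevConj N p)⁻¹ = p⁻¹ - (N : ℝ)⁻¹ := by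
  have h0 : p ≠ 0 := by linarith
  have h1 : (N : ℝ) ≠ 0 := by linarith
  have h2 : (N : ℝ) - p ≠ 0 := by linarith
  rw [sobolevConj]
  field_simp

theorem lt_sobolevConj {N : ℕ} {p : ℝ} (hp : 1 ≤ p) (hpN : p < N) : p < sobolevConj N p := by
  rw [sobolevConj, lt_div_iff₀ (by linarith)]
  nlinarith

/-- The Sobolev inequality for compactly supported functions with a weak gradient. -/
theorem IsWeakGradient.eLpNorm_le_of_hasCompactSupport {N : ℕ} {p : ℝ} (hp : 1 ≤ p) (hpN : p < N)
    {u : EuclideanSpace ℝ (Fin N) → ℝ}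
    {g : EuclideanSpace ℝ (Fin N) → EuclideanSpace ℝ (Fin N)} (h : IsWeakGradient u g)
    (hu : HasCompactSupport u) :
    eLpNorm u (ENNReal.ofReal (sobolevConj N p)) volume ≤
      SNormLESNormFDerivOfEqConst ℝ (volume : Measure (EuclideanSpace ℝ (Fin N))) p.toNNReal *
        eLpNorm g (ENNReal.ofReal p) volume := by
  set ρ : ℕ → EuclideanSpace ℝ (Fin N) → ℝ := fun n => (mollifier N n).normed volume with hρ
  have hρs : ∀ n, ContDiff ℝ ∞ (ρ n) := fun n => (mollifier N n).contDiff_normed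
  have hρc : ∀ n, HasCompactSupport (ρ n) := fun n => (mollifier N n).hasCompactSupport_normed
  -- Mollifications converge a.e., so Fatou reduces the claim to C^1 functions with compact support,
  -- where the Gagliardo–Nirenberg–Sobolev inequality applies.
  refine (Lp.eLpNorm_lim_le_liminf_eLpNorm (f := fun n => ρ n ⋆[lsmul ℝ ℝ, volume] u) (fun n => ?_) u
    (ae_tendsto_convolution_mollifier h.1)).trans ?_
  · exact (continuous_convolution_of_locallyIntegrable (hρs n).continuous (hρc n)
      h.1).aestronglyMeasurable
  refine (liminf_le_liminf (v := fun _ =>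
    SNormLESNormFDerivOfEqConst ℝ (volume : Measure (EuclideanSpace ℝ (Fin N))) p.toNNReal *
      eLpNorm g (ENNReal.ofReal p) volume) (Eventually.of_forall fun n => ?_)).trans_eq
    tendsto_const_nhds.liminf_eq
  have hv : ContDiff ℝ 1 (ρ n ⋆[lsmul ℝ ℝ, volume] u) :=
    ((hρc n).contDiff_convolution_left (n := 1) _ ((hρs n).of_le (by simp)) h.1)
  have hvc : HasCompactSupport (ρ n ⋆[lsmul ℝ ℝ, volume] u) := (hρc n).convolution _ hu
  have hpN' : 1 ≤ p.toNNReal := by simpa using hp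
  have gns := eLpNorm_le_eLpNorm_fderiv_of_eq (F := ℝ)
    (volume : Measure (EuclideanSpace ℝ (Fin N))) hv hvc
    (p := p.toNNReal) (p' := (sobolevConj N p).toNNReal) hpN'
    (by rw [finrank_euclideanSpace_fin]; exact_mod_cast (by linarith : (0 : ℝ) < N))
    (by
      rw [finrank_euclideanSpace_fin, NNReal.coe_inv,
        Real.coe_toNNReal _ (by linarith [lt_sobolevConj hp hpN]),
        Real.coe_toNNReal _ (by linarith), sobolevConj_inv hp hpN])
  refine gns.trans ?_
  gcongr
  refine le_trans (eLpNorm_mono fun x => ?_) (eLpNorm_convolution_le (hρs n).continuous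
    (mollifier N n).nonneg_normed (mollifier N n).integral_normed h.2.1.aestronglyMeasurable hp)
  rw [(h.hasFDerivAt_convolution (hρs n) (hρc n) x).fderiv, innerSL_apply_norm]

/-- Continuity from above of the finite measure f dμ along complements of balls, which decrease to
the empty set. -/
theorem tendsto_setLIntegral_compl_ball {E : Type*} [NormedAddCommGroup E] [MeasurableSpace E]
    [OpensMeasurableSpace E] {μ : Measure E} {f : E → ℝ≥0∞} (hf : ∫⁻ x, f x ∂μ ≠ ⊤) :
    Tendsto (fun n : ℕ => ∫⁻ x in (ball 0 (n : ℝ))ᶜ, f x ∂μ) atTop (𝓝 0) := by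
  have h := tendsto_measure_iInter_atTop (μ := μ.withDensity f)
    (s := fun n : ℕ => (ball (0 : E) (n : ℝ))ᶜ)
    (fun n => measurableSet_ball.compl.nullMeasurableSet)
    (fun m n hmn => compl_subset_compl.2 (ball_subset_ball (by exact_mod_cast hmn)))
    ⟨0, ne_top_of_le_ne_top hf (by
      rw [withDensity_apply _ measurableSet_ball.compl]
      exact setLIntegral_le_lintegral _ _)⟩
  have h0 : ⋂ n : ℕ, (ball (0 : E) (n : ℝ))ᶜ = ∅ := by
    rw [← compl_iUnion, iUnion_ball_nat, compl_univ]
  rw [h0, measure_empty] at h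
  exact h.congr fun n => withDensity_apply _ measurableSet_ball.compl

/-- Smooth cutoffs at scale `R` with gradient of size `O(1/R)`. -/
theorem exists_cutoff (N : ℕ) : ∃ L : ℝ, 0 ≤ L ∧ ∀ R : ℝ, 0 < R →
    ∃ χ : EuclideanSpace ℝ (Fin N) → ℝ, ContDiff ℝ ∞ χ ∧ tsupport χ ⊆ closedBall 0 (2 * R) ∧
      (∀ x, 0 ≤ χ x) ∧ (∀ x, χ x ≤ 1) ∧ (∀ x ∈ closedBall 0 R, χ x = 1) ∧
      (∀ x, ‖gradient χ x‖ ≤ L / R) ∧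
      (∀ x, x ∉ closedBall 0 (2 * R) \ ball 0 R → gradient χ x = 0) := by
  -- A single profile is rescaled, χ(x) = b(x/R), so one bound L on its derivative serves every R.
  let b : ContDiffBump (0 : EuclideanSpace ℝ (Fin N)) := ⟨1, 2, one_pos, one_lt_two⟩
  have hb : ContDiff ℝ ∞ b := b.contDiff
  obtain ⟨L, hL⟩ := (b.hasCompactSupport.fderiv ℝ).exists_bound_of_continuous
    (hb.continuous_fderiv (by simp))
  have hnorm : ∀ (f : EuclideanSpace ℝ (Fin N) → ℝ) x, ‖gradient f x‖ = ‖fderiv ℝ f x‖ :=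
    fun f x => LinearIsometryEquiv.norm_map _ _
  refine ⟨L, (norm_nonneg _).trans (hL 0), fun R hR => ⟨fun x => b (R⁻¹ • x), ?_, ?_, ?_, ?_, ?_, ?_,
    ?_⟩⟩
  · exact hb.comp (contDiff_const_smul _)
  · refine closure_minimal (fun x hx => ?_) isClosed_closedBall
    have hx' : R⁻¹ • x ∈ Function.support b := hx
    rw [b.support_eq, mem_ball_zero_iff, norm_smul, norm_inv, Real.norm_of_nonneg hR.le] at hx'
    rw [mem_closedBall_zero_iff]
    have : R⁻¹ * ‖x‖ < 2 := hx'
    rw [inv_mul_lt_iff₀ hR] at this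
    linarith
  · exact fun x => b.nonneg
  · exact fun x => b.le_one
  · intro x hx
    refine b.one_of_mem_closedBall ?_
    rw [mem_closedBall_zero_iff] at hx ⊢
    rw [norm_smul, norm_inv, Real.norm_of_nonneg hR.le]
    change R⁻¹ * ‖x‖ ≤ 1
    rw [inv_mul_le_iff₀ hR]; linarith
  · intro x
    rw [hnorm, fderiv_comp_smul, norm_smul, norm_inv, Real.norm_of_nonneg hR.le, div_eq_inv_mul]
    gcongr
    exact hL _
  · intro x hx
    rw [← norm_eq_zero, hnorm, norm_eq_zero]
    rw [Set.mem_sdiff, not_and, not_not] at hx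
    by_cases h2 : x ∈ closedBall 0 (2 * R)
    · have : (fun x => b (R⁻¹ • x)) =ᶠ[𝓝 x] fun _ => 1 := by
        filter_upwards [isOpen_ball.mem_nhds (hx h2)] with y hy
        refine b.one_of_mem_closedBall ?_
        rw [mem_ball_zero_iff] at hy
        rw [mem_closedBall_zero_iff, norm_smul, norm_inv, Real.norm_of_nonneg hR.le]
        change R⁻¹ * ‖y‖ ≤ 1
        rw [inv_mul_le_iff₀ hR]; linarith
      rw [this.fderiv_eq, fderiv_fun_const]; rfl
    · have : (fun x => b (R⁻¹ • x)) =ᶠ[𝓝 x] fun _ => 0 := by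
        filter_upwards [isClosed_closedBall.isOpen_compl.mem_nhds h2] with y hy
        refine b.zero_of_le_dist ?_
        rw [mem_compl_iff, mem_closedBall_zero_iff, not_le] at hy
        rw [dist_zero_right, norm_smul, norm_inv, Real.norm_of_nonneg hR.le]
        change 2 ≤ R⁻¹ * ‖y‖
        rw [le_inv_mul_iff₀ hR]; linarith
      rw [this.fderiv_eq, fderiv_fun_const]; rfl

/-- Hölder on an annulus of measure O(R^N): since 1/p - 1/p* = 1/N, it costs a factor O(R), which
cancels the size 1/R of the cutoff gradient. Only a tail of the L^(p*) norm remains, and it vanishes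
as R grows. -/
theorem eLpNorm_smul_cutoff_gradient_le {N : ℕ} {p : ℝ} (hp : 1 ≤ p) (hpN : p < N)
    {u : EuclideanSpace ℝ (Fin N) → ℝ} (hu : AEStronglyMeasurable u volume)
    {L R : ℝ} (hL : 0 ≤ L) (hR : 0 < R) {G : EuclideanSpace ℝ (Fin N) → EuclideanSpace ℝ (Fin N)}
    (hG : ∀ x, ‖G x‖ ≤ L / R) (hG0 : ∀ x, x ∉ closedBall 0 (2 * R) \ ball 0 R → G x = 0) :
    eLpNorm (fun x => u x • G x) (ENNReal.ofReal p) volume ≤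
      ENNReal.ofReal (2 * L) * volume (ball (0 : EuclideanSpace ℝ (Fin N)) 1) ^ (N : ℝ)⁻¹ *
        eLpNorm u (ENNReal.ofReal (sobolevConj N p)) (volume.restrict (ball 0 R)ᶜ) := by
  set A : Set (EuclideanSpace ℝ (Fin N)) := closedBall 0 (2 * R) \ ball 0 R with hA
  have hAm : MeasurableSet A := measurableSet_closedBall.diff measurableSet_ball
  have hps := lt_sobolevConj hp hpN
  have h1 : eLpNorm (fun x => u x • G x) (ENNReal.ofReal p) volume ≤
      ENNReal.ofReal (L / R) * eLpNorm u (ENNReal.ofReal p) (volume.restrict A) := by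
    rw [← eLpNorm_indicator_eq_eLpNorm_restrict hAm]
    refine eLpNorm_le_mul_eLpNorm_of_ae_le_mul (Eventually.of_forall fun x => ?_) _
    by_cases hx : x ∈ A
    · rw [indicator_of_mem hx, norm_smul, mul_comm]
      gcongr
      exact hG x
    · rw [hG0 x hx, smul_zero, norm_zero]
      positivity
  have h2 : eLpNorm u (ENNReal.ofReal p) (volume.restrict A) ≤
      eLpNorm u (ENNReal.ofReal (sobolevConj N p)) (volume.restrict A) *
        volume A ^ (N : ℝ)⁻¹ := by
    have := eLpNorm_le_eLpNorm_mul_rpow_measure_univ (μ := volume.restrict A)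
      (ENNReal.ofReal_le_ofReal hps.le) hu.restrict
    rw [ENNReal.toReal_ofReal (by linarith), ENNReal.toReal_ofReal (by linarith), one_div, one_div,
      sobolevConj_inv hp hpN, sub_sub_cancel, Measure.restrict_apply_univ] at this
    exact this
  have hN : (0 : ℝ) < N := by linarith
  have h3 : volume A ^ (N : ℝ)⁻¹ ≤ ENNReal.ofReal (2 * R) *
      volume (ball (0 : EuclideanSpace ℝ (Fin N)) 1) ^ (N : ℝ)⁻¹ := by
    have : volume A ≤ ENNReal.ofReal (2 * R) ^ (N : ℝ) *
        volume (ball (0 : EuclideanSpace ℝ (Fin N)) 1) := by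
      refine (measure_mono sdiff_subset).trans_eq ?_
      rw [Measure.addHaar_closedBall _ _ (by positivity), finrank_euclideanSpace_fin,
        ENNReal.ofReal_pow (by positivity), ENNReal.rpow_natCast]
    refine (ENNReal.rpow_le_rpow this (by positivity)).trans_eq ?_
    rw [ENNReal.mul_rpow_of_nonneg _ _ (by positivity), ← ENNReal.rpow_mul,
      mul_inv_cancel₀ hN.ne', ENNReal.rpow_one]
  have h4 : eLpNorm u (ENNReal.ofReal (sobolevConj N p)) (volume.restrict A) ≤
      eLpNorm u (ENNReal.ofReal (sobolevConj N p)) (volume.restrict (ball 0 R)ᶜ) :=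
    eLpNorm_mono_measure _ (Measure.restrict_mono (fun x hx => hx.2) le_rfl)
  calc _ ≤ ENNReal.ofReal (L / R) *
        (eLpNorm u (ENNReal.ofReal (sobolevConj N p)) (volume.restrict (ball 0 R)ᶜ) *
          (ENNReal.ofReal (2 * R) *
            volume (ball (0 : EuclideanSpace ℝ (Fin N)) 1) ^ (N : ℝ)⁻¹)) := by
        refine h1.trans ?_
        gcongr
        exact h2.trans (mul_le_mul' h4 h3)
    _ = (ENNReal.ofReal (L / R) * ENNReal.ofReal (2 * R)) *
          volume (ball (0 : EuclideanSpace ℝ (Fin N)) 1) ^ (N : ℝ)⁻¹ *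
          eLpNorm u (ENNReal.ofReal (sobolevConj N p)) (volume.restrict (ball 0 R)ᶜ) := by ring
    _ = _ := by
        rw [← ENNReal.ofReal_mul (by positivity)]
        congr 3
        field_simp

/-- The Sobolev inequality in `D^{1,p}(ℝ^N)`. -/
theorem IsWeakGradient.eLpNorm_sobolevConj_le {N : ℕ} {p : ℝ} (hp : 1 ≤ p) (hpN : p < N)
    {u : EuclideanSpace ℝ (Fin N) → ℝ}
    {g : EuclideanSpace ℝ (Fin N) → EuclideanSpace ℝ (Fin N)} (h : IsWeakGradient u g)
    (hu : MemLp u (ENNReal.ofReal (sobolevConj N p)) volume) :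
    eLpNorm u (ENNReal.ofReal (sobolevConj N p)) volume ≤
      SNormLESNormFDerivOfEqConst ℝ (volume : Measure (EuclideanSpace ℝ (Fin N))) p.toNNReal *
        eLpNorm g (ENNReal.ofReal p) volume := by
  set C : ℝ≥0 :=
    SNormLESNormFDerivOfEqConst ℝ (volume : Measure (EuclideanSpace ℝ (Fin N))) p.toNNReal
  have hps := lt_sobolevConj hp hpN
  have hps0 : 0 < sobolevConj N p := by linarith
  obtain ⟨L, hL, H⟩ := exists_cutoff N
  choose χ hχ hsupp h0 h1 hone hgrad hgrad0 using
    fun n : ℕ => H ((n : ℝ) + 1) (by positivity)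
  have hχc : ∀ n, HasCompactSupport (χ n) := fun n =>
    (isCompact_closedBall _ _).of_isClosed_subset (isClosed_tsupport _) (hsupp n)
  set D := ENNReal.ofReal (2 * L) * volume (ball (0 : EuclideanSpace ℝ (Fin N)) 1) ^ (N : ℝ)⁻¹
    with hD
  set T : ℕ → ℝ≥0∞ := fun n =>
    eLpNorm u (ENNReal.ofReal (sobolevConj N p)) (volume.restrict (ball 0 ((n : ℝ) + 1))ᶜ) with hT
  have hTlim : Tendsto T atTop (𝓝 0) := by
    have hpe : ENNReal.ofReal (sobolevConj N p) ≠ 0 := by simpa using hps0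
    have hfin : ∫⁻ x, ‖u x‖ₑ ^ sobolevConj N p ≠ ⊤ := by
      have := lintegral_rpow_enorm_lt_top_of_eLpNorm_lt_top hpe ENNReal.ofReal_ne_top hu.2
      rw [ENNReal.toReal_ofReal hps0.le] at this
      exact this.ne
    have t1 := (tendsto_add_atTop_iff_nat 1).2 (tendsto_setLIntegral_compl_ball hfin)
    have t2 := t1.ennrpow_const (1 / sobolevConj N p)
    rw [ENNReal.zero_rpow_of_pos (by positivity)] at t2
    refine t2.congr fun n => ?_
    simp only [hT, eLpNorm_eq_lintegral_rpow_enorm_toReal hpe ENNReal.ofReal_ne_top,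
      ENNReal.toReal_ofReal hps0.le, Nat.cast_add, Nat.cast_one]
  have hDtop : D ≠ ⊤ := ENNReal.mul_ne_top ENNReal.ofReal_ne_top
    (ENNReal.rpow_ne_top_of_nonneg (by positivity) measure_ball_lt_top.ne)
  have hbound : ∀ n, eLpNorm (fun x => χ n x * u x) (ENNReal.ofReal (sobolevConj N p)) volume ≤
      C * (eLpNorm g (ENNReal.ofReal p) volume + D * T n) := by
    intro n
    have hw := h.mul_contDiff (hχ n)
    refine (hw.eLpNorm_le_of_hasCompactSupport hp hpN (hχc n).mul_right).trans ?_
    gcongr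
    refine (eLpNorm_add_le (h.2.1.continuous_smul (hχ n).continuous).aestronglyMeasurable
      (h.1.smul_continuous ((InnerProductSpace.toDual ℝ _).symm.continuous.comp
        ((hχ n).continuous_fderiv (by simp)))).aestronglyMeasurable (by simpa using hp)).trans ?_
    gcongr
    · refine eLpNorm_mono fun x => ?_
      rw [norm_smul, Real.norm_of_nonneg (h0 n x)]
      exact mul_le_of_le_one_left (norm_nonneg _) (h1 n x)
    · exact eLpNorm_smul_cutoff_gradient_le hp hpN hu.1 hL (by positivity) (hgrad n) (hgrad0 n)
  -- Fatou for the cutoffs, which equal u at each fixed point for large n; the error D * T n in the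
  -- bound tends to zero.
  refine (Lp.eLpNorm_lim_le_liminf_eLpNorm (f := fun n x => χ n x * u x) (fun n => ?_) u
    (Eventually.of_forall fun x => ?_)).trans ((liminf_le_liminf (Eventually.of_forall
      hbound)).trans_eq ?_)
  · exact (hχ n).continuous.aestronglyMeasurable.mul hu.1
  · refine tendsto_const_nhds.congr' ?_
    filter_upwards [eventually_ge_atTop ⌈‖x‖⌉₊] with n hn
    rw [hone n x, one_mul]
    rw [mem_closedBall_zero_iff]
    have := Nat.ceil_le.1 hn
    linarith
  · refine Tendsto.liminf_eq ?_
    have := ENNReal.Tendsto.const_mul (a := D) hTlim (Or.inr hDtop)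
    rw [mul_zero] at this
    have := (tendsto_const_nhds (x := eLpNorm g (ENNReal.ofReal p) volume)).add this
    rw [add_zero] at this
    exact ENNReal.Tendsto.const_mul this (Or.inr ENNReal.coe_ne_top)

/-! ### Translation estimates and Rellich–Kondrachov on balls -/

/-- The fundamental theorem of calculus along the segment from x to x - h, followed by Tonelli and
translation invariance. -/
theorem lintegral_enorm_sub_translate_le_of_contDiff {N : ℕ} {v : EuclideanSpace ℝ (Fin N) → ℝ}
    (hv : ContDiff ℝ 1 v) (h : EuclideanSpace ℝ (Fin N)) :
    ∫⁻ x, ‖v (x - h) - v x‖ₑ ≤ ‖h‖ₑ * ∫⁻ x, ‖fderiv ℝ v x‖ₑ := by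
  have hc : Continuous (fderiv ℝ v) := hv.continuous_fderiv one_ne_zero
  have hb : ∀ x, ‖v (x - h) - v x‖ₑ ≤ ∫⁻ t in Ioc (0 : ℝ) 1, ‖fderiv ℝ v (x - t • h)‖ₑ * ‖h‖ₑ := by
    intro x
    have hd : ∀ t : ℝ, HasDerivAt (fun t : ℝ => v (x - t • h)) (fderiv ℝ v (x - t • h) (-h)) t := by
      intro t
      have h1 : HasDerivAt (fun t : ℝ => x - t • h) (-h) t := by
        simpa using ((hasDerivAt_id t).smul_const h).const_sub x
      exact ((hv.differentiable one_ne_zero) _).hasFDerivAt.comp_hasDerivAt t h1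
    have hcont : Continuous fun t : ℝ => fderiv ℝ v (x - t • h) (-h) := by fun_prop
    have e := intervalIntegral.integral_eq_sub_of_hasDerivAt (a := 0) (b := 1)
      (fun t _ => hd t) (hcont.intervalIntegrable _ _)
    simp only [one_smul, zero_smul, sub_zero] at e
    rw [← e, intervalIntegral.integral_of_le zero_le_one]
    refine (enorm_integral_le_lintegral_enorm _).trans (lintegral_mono fun t => ?_)
    refine (ContinuousLinearMap.le_opENorm _ _).trans_eq ?_
    rw [enorm_neg]
  calc ∫⁻ x, ‖v (x - h) - v x‖ₑ
      ≤ ∫⁻ x, ∫⁻ t in Ioc (0 : ℝ) 1, ‖fderiv ℝ v (x - t • h)‖ₑ * ‖h‖ₑ := lintegral_mono hb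
    _ = ∫⁻ t in Ioc (0 : ℝ) 1, (∫⁻ x, ‖fderiv ℝ v (x - t • h)‖ₑ * ‖h‖ₑ) := by
        refine lintegral_lintegral_swap ?_
        refine Measurable.aemeasurable ?_
        have : Continuous fun z : EuclideanSpace ℝ (Fin N) × ℝ => fderiv ℝ v (z.1 - z.2 • h) := by
          fun_prop
        exact this.measurable.enorm.mul_const _
    _ = ∫⁻ t in Ioc (0 : ℝ) 1, (∫⁻ x, ‖fderiv ℝ v x‖ₑ * ‖h‖ₑ) := by
        refine lintegral_congr fun t => ?_
        exact lintegral_sub_right_eq_self (fun x => ‖fderiv ℝ v x‖ₑ * ‖h‖ₑ) (t • h)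
    _ = ‖h‖ₑ * ∫⁻ x, ‖fderiv ℝ v x‖ₑ := by
        rw [lintegral_const, Measure.restrict_apply_univ, Real.volume_Ioc, sub_zero,
          ENNReal.ofReal_one, mul_one, lintegral_mul_const _ hc.measurable.enorm, mul_comm]

/-- The smooth estimate holds for the mollifications, whose gradients are mollifications of g and
hence no larger in L^1; Fatou passes to the limit. -/
theorem IsWeakGradient.lintegral_enorm_sub_translate_le {N : ℕ}
    {u : EuclideanSpace ℝ (Fin N) → ℝ}
    {g : EuclideanSpace ℝ (Fin N) → EuclideanSpace ℝ (Fin N)} (hu : IsWeakGradient u g)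
    (h : EuclideanSpace ℝ (Fin N)) :
    ∫⁻ x, ‖u (x - h) - u x‖ₑ ≤ ‖h‖ₑ * ∫⁻ x, ‖g x‖ₑ := by
  set ρ : ℕ → EuclideanSpace ℝ (Fin N) → ℝ := fun n => (mollifier N n).normed volume with hρ
  have hρs : ∀ n, ContDiff ℝ ∞ (ρ n) := fun n => (mollifier N n).contDiff_normed
  have hρc : ∀ n, HasCompactSupport (ρ n) := fun n => (mollifier N n).hasCompactSupport_normed
  have hvc : ∀ n, Continuous (ρ n ⋆[lsmul ℝ ℝ, volume] u) := fun n =>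
    continuous_convolution_of_locallyIntegrable (hρs n).continuous (hρc n) hu.1
  have hlim := ae_tendsto_convolution_mollifier hu.1
  have hlim' := (measurePreserving_sub_right volume h).quasiMeasurePreserving.ae hlim
  rw [← eLpNorm_one_eq_lintegral_enorm, ← eLpNorm_one_eq_lintegral_enorm]
  refine (Lp.eLpNorm_lim_le_liminf_eLpNorm (f := fun n x => (ρ n ⋆[lsmul ℝ ℝ, volume] u) (x - h) -
    (ρ n ⋆[lsmul ℝ ℝ, volume] u) x) (fun n => ?_) _ ?_).trans ?_
  · exact (((hvc n).comp (continuous_sub_right h)).sub (hvc n)).aestronglyMeasurable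
  · filter_upwards [hlim, hlim'] with x h1 h2
    exact h2.sub h1
  refine (liminf_le_liminf (v := fun _ => ‖h‖ₑ * eLpNorm g 1 volume)
    (Eventually.of_forall fun n => ?_)).trans_eq tendsto_const_nhds.liminf_eq
  have hv : ContDiff ℝ 1 (ρ n ⋆[lsmul ℝ ℝ, volume] u) :=
    ((hρc n).contDiff_convolution_left (n := 1) _ ((hρs n).of_le (by simp)) hu.1)
  rw [eLpNorm_one_eq_lintegral_enorm]
  refine (lintegral_enorm_sub_translate_le_of_contDiff hv h).trans ?_
  rw [← eLpNorm_one_eq_lintegral_enorm]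
  gcongr
  have := eLpNorm_convolution_le (hρs n).continuous
    (mollifier N n).nonneg_normed (mollifier N n).integral_normed hu.2.1.aestronglyMeasurable le_rfl
  rw [ENNReal.ofReal_one] at this
  refine le_trans (eLpNorm_mono fun x => ?_) this
  rw [(hu.hasFDerivAt_convolution (hρs n) (hρc n) x).fderiv, innerSL_apply_norm]

/-- Mollification at scale `ε` is `ε`-close to the identity in `L^1`, relative to the gradient. -/
theorem IsWeakGradient.lintegral_enorm_convolution_sub_le {N : ℕ}
    {u : EuclideanSpace ℝ (Fin N) → ℝ}
    {g : EuclideanSpace ℝ (Fin N) → EuclideanSpace ℝ (Fin N)} (hu : IsWeakGradient u g)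
    {φ : EuclideanSpace ℝ (Fin N) → ℝ} (hφ : Continuous φ) (hc : HasCompactSupport φ)
    (h0 : ∀ x, 0 ≤ φ x) (h1 : ∫ x, φ x = 1) {ε : ℝ} (hε : Function.support φ ⊆ ball 0 ε) :
    ∫⁻ x, ‖(φ ⋆[lsmul ℝ ℝ, volume] u) x - u x‖ₑ ≤ ENNReal.ofReal ε * ∫⁻ x, ‖g x‖ₑ := by
  have hum : AEStronglyMeasurable u volume := hu.1.aestronglyMeasurable
  have hφm : Measurable fun x => ENNReal.ofReal (φ x) := hφ.measurable.ennreal_ofReal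
  have hb : ∀ x, ‖(φ ⋆[lsmul ℝ ℝ, volume] u) x - u x‖ₑ ≤
      ∫⁻ s, ENNReal.ofReal (φ s) * ‖u (x - s) - u x‖ₑ := by
    intro x
    have i1 : Integrable fun s => φ s • u (x - s) :=
      (hc.convolutionExists_left (lsmul ℝ ℝ) hφ hu.1 x)
    have i2 : Integrable fun s => φ s • u x :=
      (hφ.integrable_of_hasCompactSupport hc).smul_const _
    -- As φ has mass one, the difference is the φ-average of u(x - s) - u(x), so only translations
    -- by |s| < ε matter.
    have e : (φ ⋆[lsmul ℝ ℝ, volume] u) x - u x = ∫ s, φ s • (u (x - s) - u x) := by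
      simp only [smul_sub]
      rw [integral_sub i1 i2, integral_smul_const, h1, one_smul, convolution_lsmul]
    rw [e]
    refine (enorm_integral_le_lintegral_enorm _).trans_eq (lintegral_congr fun s => ?_)
    rw [enorm_smul, Real.enorm_of_nonneg (h0 s)]
  have hm : AEMeasurable (fun z : EuclideanSpace ℝ (Fin N) × EuclideanSpace ℝ (Fin N) =>
      ENNReal.ofReal (φ z.2) * ‖u (z.1 - z.2) - u z.1‖ₑ) (volume.prod volume) := by
    refine (hφm.comp measurable_snd).aemeasurable.mul (AEStronglyMeasurable.enorm ?_)
    exact (hum.comp_quasiMeasurePreserving (quasiMeasurePreserving_sub volume volume)).sub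
      (hum.comp_quasiMeasurePreserving Measure.quasiMeasurePreserving_fst)
  calc ∫⁻ x, ‖(φ ⋆[lsmul ℝ ℝ, volume] u) x - u x‖ₑ
      ≤ ∫⁻ x, ∫⁻ s, ENNReal.ofReal (φ s) * ‖u (x - s) - u x‖ₑ := lintegral_mono hb
    _ = ∫⁻ s, ∫⁻ x, ENNReal.ofReal (φ s) * ‖u (x - s) - u x‖ₑ := lintegral_lintegral_swap hm
    _ ≤ ∫⁻ s, ENNReal.ofReal (φ s) * (ENNReal.ofReal ε * ∫⁻ x, ‖g x‖ₑ) := by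
        refine lintegral_mono fun s => ?_
        rw [lintegral_const_mul' _ _ ENNReal.ofReal_ne_top]
        by_cases hs : s ∈ Function.support φ
        · refine mul_le_mul' le_rfl ((hu.lintegral_enorm_sub_translate_le s).trans ?_)
          refine mul_le_mul' ?_ le_rfl
          rw [← ofReal_norm]
          exact ENNReal.ofReal_le_ofReal (mem_ball_zero_iff.1 (hε hs)).le
        · rw [Function.notMem_support.1 hs]; simp
    _ = ENNReal.ofReal ε * ∫⁻ x, ‖g x‖ₑ := by
        rw [lintegral_mul_const _ hφm, lintegral_ofReal_eq_one h0 h1, one_mul]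

/-- Mollifications of a bounded family in `L^1` have finite nets for uniform convergence on compact
sets. -/
theorem exists_finite_net_convolution {N : ℕ} {ι : Type*}
    {φ : EuclideanSpace ℝ (Fin N) → ℝ} (hφ : Continuous φ) (hc : HasCompactSupport φ)
    {w : ι → EuclideanSpace ℝ (Fin N) → ℝ} (hw : ∀ i, Integrable (w i)) {M : ℝ}
    (hM : ∀ i, ∫ x, ‖w i x‖ ≤ M) {B : Set (EuclideanSpace ℝ (Fin N))} (hB : IsCompact B)
    {δ : ℝ} (hδ : 0 < δ) :
    ∃ t : Set ι, t.Finite ∧ ∀ i, ∃ j ∈ t, ∀ x ∈ B,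
      dist ((φ ⋆[lsmul ℝ ℝ, volume] w i) x) ((φ ⋆[lsmul ℝ ℝ, volume] w j) x) < δ := by
  rcases isEmpty_or_nonempty ι with hι | ⟨⟨i₀⟩⟩
  · exact ⟨∅, finite_empty, fun i => hι.elim i⟩
  have hM0 : 0 ≤ M := (integral_nonneg fun _ => norm_nonneg _).trans (hM i₀)
  have hint : ∀ i x, Integrable fun t => φ (x - t) • w i t := fun i x =>
    (hc.convolutionExists_left (lsmul ℝ ℝ) hφ (hw i).locallyIntegrable x).integrable_swap
  obtain ⟨C, hC⟩ := hc.exists_bound_of_continuous hφ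
  have hbd : ∀ i x, ‖(φ ⋆[lsmul ℝ ℝ, volume] w i) x‖ ≤ C * M := by
    intro i x
    have hC0 : 0 ≤ C := (norm_nonneg _).trans (hC 0)
    rw [convolution_lsmul_swap]
    calc ‖∫ t, φ (x - t) • w i t‖ ≤ ∫ t, C * ‖w i t‖ := by
          refine norm_integral_le_of_norm_le ((hw i).norm.const_mul C)
            (Eventually.of_forall fun t => ?_)
          rw [norm_smul]
          exact mul_le_mul_of_nonneg_right (hC _) (norm_nonneg _)
      _ ≤ C * M := by
          rw [integral_const_mul]
          exact mul_le_mul_of_nonneg_left (hM i) hC0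
  -- The modulus of continuity of φ times the common L^1 bound gives uniform equicontinuity. The
  -- denominator M + 1 covers M = 0 and makes the last inequality strict.
  have hequi : ∀ η > 0, ∃ r > 0, ∀ x y, dist x y < r → ∀ i,
      dist ((φ ⋆[lsmul ℝ ℝ, volume] w i) x) ((φ ⋆[lsmul ℝ ℝ, volume] w i) y) < η := by
    intro η hη
    obtain ⟨r, hr, H⟩ := Metric.uniformContinuous_iff.1 (hc.uniformContinuous_of_continuous hφ)
      (η / (M + 1)) (by positivity)
    refine ⟨r, hr, fun x y hxy i => ?_⟩
    rw [dist_eq_norm, convolution_lsmul_swap, convolution_lsmul_swap,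
      ← integral_sub (hint i x) (hint i y)]
    calc ‖∫ t, (φ (x - t) • w i t - φ (y - t) • w i t)‖ ≤ ∫ t, η / (M + 1) * ‖w i t‖ := by
          refine norm_integral_le_of_norm_le ((hw i).norm.const_mul _)
            (Eventually.of_forall fun t => ?_)
          rw [← sub_smul, norm_smul]
          refine mul_le_mul_of_nonneg_right ?_ (norm_nonneg _)
          rw [← dist_eq_norm]
          exact (H (by simpa using hxy)).le
      _ ≤ η / (M + 1) * M := by
          rw [integral_const_mul]
          exact mul_le_mul_of_nonneg_left (hM i) (by positivity)
      _ < η := by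
          rw [div_mul_eq_mul_div, div_lt_iff₀ (by positivity)]
          nlinarith
  have : CompactSpace B := isCompact_iff_compactSpace.1 hB
  let F : ι → BoundedContinuousFunction B ℝ := fun i =>
    BoundedContinuousFunction.mkOfCompact ⟨fun x : B => (φ ⋆[lsmul ℝ ℝ, volume] w i) x,
      (continuous_convolution_of_locallyIntegrable hφ hc (hw i).locallyIntegrable).comp
        continuous_subtype_val⟩
  have hcpt : IsCompact (closure (range F)) := by
    refine BoundedContinuousFunction.arzela_ascoli (closedBall 0 (C * M))
      (isCompact_closedBall _ _) _ ?_ ?_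
    · rintro _ x ⟨i, rfl⟩
      rw [mem_closedBall_zero_iff]
      exact hbd i x
    · intro x
      rw [Metric.equicontinuousAt_iff]
      intro η hη
      obtain ⟨r, hr, H⟩ := hequi η hη
      refine ⟨r, hr, fun y hy => ?_⟩
      rintro ⟨_, i, rfl⟩
      rw [dist_comm] at hy
      exact H x y hy i
  have htb : TotallyBounded (range F) := hcpt.totallyBounded.subset subset_closure
  obtain ⟨t, hts, htf, hcov⟩ := totallyBounded_iff_subset.1 htb _ (dist_mem_uniformity hδ)
  have : Nonempty ι := ⟨i₀⟩
  have hts' : ∀ y ∈ t, ∃ i, F i = y := fun y hy => hts hy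
  choose! c hcF using hts'
  refine ⟨c '' t, htf.image c, fun i => ?_⟩
  obtain ⟨y, hy, hiy⟩ := mem_iUnion₂.1 (hcov (mem_range_self i))
  refine ⟨c y, mem_image_of_mem c hy, fun x hx => ?_⟩
  have h1 : dist (F i) (F (c y)) < δ := by rw [hcF y hy]; exact hiy
  exact (BoundedContinuousFunction.dist_coe_le_dist (f := F i) (g := F (c y)) ⟨x, hx⟩).trans_lt h1

theorem setLIntegral_enorm_le_of_eLpNorm_le {α F : Type*} [MeasurableSpace α]
    [NormedAddCommGroup F] {μ : Measure α} {f : α → F} (hf : AEStronglyMeasurable f μ) {a : ℝ}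
    (ha : 1 ≤ a) {M : ℝ≥0} (hM : eLpNorm f (ENNReal.ofReal a) μ ≤ M) (B : Set α) :
    ∫⁻ x in B, ‖f x‖ₑ ∂μ ≤ M * μ B ^ (1 - 1 / a) := by
  have := eLpNorm_le_eLpNorm_mul_rpow_measure_univ (μ := μ.restrict B) (p := 1)
    (q := ENNReal.ofReal a) (by simpa using ha) hf.restrict
  rw [eLpNorm_one_eq_lintegral_enorm, ENNReal.toReal_one, ENNReal.toReal_ofReal (by linarith),
    Measure.restrict_apply_univ, div_one] at this
  refine this.trans ?_
  gcongr
  exact (eLpNorm_mono_measure _ Measure.restrict_le_self).trans hM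

theorem exists_coe_eq_of_ne_top {a : ℝ≥0∞} (h : a ≠ ⊤) : ∃ b : ℝ≥0, (b : ℝ≥0∞) = a :=
  ⟨a.toNNReal, ENNReal.coe_toNNReal h⟩

/-- The Rellich–Kondrachov theorem on balls: a family which is bounded in `L^a` and whose weak
gradients are bounded in `L^b` is totally bounded in `L^1` of each ball. -/
theorem exists_finite_net_setLIntegral_ball {N : ℕ} {ι : Type*}
    {u : ι → EuclideanSpace ℝ (Fin N) → ℝ}
    {g : ι → EuclideanSpace ℝ (Fin N) → EuclideanSpace ℝ (Fin N)}
    (h : ∀ i, IsWeakGradient (u i) (g i)) {a b : ℝ} (ha : 1 ≤ a) (hb : 1 ≤ b) {M : ℝ≥0}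
    (hu : ∀ i, eLpNorm (u i) (ENNReal.ofReal a) volume ≤ M)
    (hg : ∀ i, eLpNorm (g i) (ENNReal.ofReal b) volume ≤ M) {R : ℝ} (hR : 0 < R)
    {δ : ℝ} (hδ : 0 < δ) :
    ∃ t : Set ι, t.Finite ∧ ∀ i, ∃ j ∈ t,
      ∫⁻ x in closedBall 0 R, ‖u i x - u j x‖ₑ ≤ ENNReal.ofReal δ := by
  obtain ⟨L, hL, H⟩ := exists_cutoff N
  obtain ⟨χ, hχ, hsupp, h0, h1, hone, hgrad, hgrad0⟩ := H R hR
  have hB : IsCompact (closedBall (0 : EuclideanSpace ℝ (Fin N)) (2 * R)) := isCompact_closedBall _ _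
  set B := closedBall (0 : EuclideanSpace ℝ (Fin N)) (2 * R)
  have hBtop : volume B ≠ ⊤ := hB.measure_lt_top.ne
  -- Hölder's constant on the ball B of radius 2R: it converts the L^a and L^b bounds into L^1
  -- bounds for the cut-off functions and their gradients.
  have hBtop' : ∀ c : ℝ, 1 ≤ c → volume B ^ (1 - 1 / c) ≠ ⊤ := fun c hc =>
    ENNReal.rpow_ne_top_of_nonneg (by
      rw [sub_nonneg, div_le_one (by linarith)]; exact hc) hBtop
  have hχ0 : ∀ x, x ∉ B → χ x = 0 := fun x hx =>
    image_eq_zero_of_notMem_tsupport fun hx' => hx (hsupp hx')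
  have hG0 : ∀ x, x ∉ B → gradient χ x = 0 := fun x hx => hgrad0 x fun hx' => hx hx'.1
  set w : ι → EuclideanSpace ℝ (Fin N) → ℝ := fun i x => χ x * u i x
  set G : ι → EuclideanSpace ℝ (Fin N) → EuclideanSpace ℝ (Fin N) := fun i x =>
    χ x • g i x + u i x • gradient χ x
  have hw : ∀ i, IsWeakGradient (w i) (G i) := fun i => (h i).mul_contDiff hχ
  obtain ⟨M₁, hM₁⟩ := exists_coe_eq_of_ne_top
    (ENNReal.mul_ne_top (ENNReal.coe_ne_top (r := M)) (hBtop' a ha))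
  obtain ⟨M₂, hM₂⟩ := exists_coe_eq_of_ne_top
    (ENNReal.mul_ne_top (ENNReal.coe_ne_top (r := M)) (hBtop' b hb))
  have hu1 : ∀ i, ∫⁻ x in B, ‖u i x‖ₑ ≤ M₁ := fun i =>
    (setLIntegral_enorm_le_of_eLpNorm_le (h i).1.aestronglyMeasurable ha (hu i) B).trans_eq hM₁.symm
  have hg1 : ∀ i, ∫⁻ x in B, ‖g i x‖ₑ ≤ M₂ := fun i =>
    (setLIntegral_enorm_le_of_eLpNorm_le (h i).2.1.aestronglyMeasurable hb (hg i) B).trans_eq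
      hM₂.symm
  have hχe : ∀ x, ‖χ x‖ₑ ≤ 1 := fun x => by
    rw [Real.enorm_of_nonneg (h0 x)]
    exact ENNReal.ofReal_le_one.2 (h1 x)
  have hw1 : ∀ i, ∫⁻ x, ‖w i x‖ₑ ≤ M₁ := fun i => by
    refine le_trans ?_ (hu1 i)
    rw [← lintegral_indicator hB.measurableSet]
    refine lintegral_mono fun x => ?_
    by_cases hx : x ∈ B
    · rw [indicator_of_mem hx, enorm_mul]
      exact mul_le_of_le_one_left' (hχe x)
    · simp [w, hχ0 x hx]
  have hG1 : ∀ i, ∫⁻ x, ‖G i x‖ₑ ≤ (M₂ + (L / R).toNNReal * M₁ : ℝ≥0) := fun i => by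
    calc ∫⁻ x, ‖G i x‖ₑ ≤ ∫⁻ x in B, (‖g i x‖ₑ + ENNReal.ofReal (L / R) * ‖u i x‖ₑ) := by
          rw [← lintegral_indicator hB.measurableSet]
          refine lintegral_mono fun x => ?_
          by_cases hx : x ∈ B
          · rw [indicator_of_mem hx]
            refine (enorm_add_le _ _).trans (add_le_add ?_ ?_)
            · rw [enorm_smul]
              exact mul_le_of_le_one_left' (hχe x)
            · rw [enorm_smul, mul_comm]
              refine mul_le_mul' ?_ le_rfl
              rw [← ofReal_norm]
              exact ENNReal.ofReal_le_ofReal (hgrad x)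
          · simp [G, hχ0 x hx, hG0 x hx]
      _ = (∫⁻ x in B, ‖g i x‖ₑ) + ENNReal.ofReal (L / R) * ∫⁻ x in B, ‖u i x‖ₑ := by
          rw [lintegral_add_left' (h i).2.1.aestronglyMeasurable.enorm.restrict,
            lintegral_const_mul' _ _ ENNReal.ofReal_ne_top]
      _ ≤ _ := by
          rw [ENNReal.coe_add, ENNReal.coe_mul]
          exact add_le_add (hg1 i) (mul_le_mul' le_rfl (hu1 i))
  set M₃ : ℝ≥0 := M₂ + (L / R).toNNReal * M₁
  -- The mollification scale is chosen so that scale times gradient bound is at most δ/3. The other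
  -- two thirds go to the second mollified function and to the uniform net.
  obtain ⟨n, hn⟩ := exists_nat_one_div_lt (show 0 < δ / 3 / (M₃ + 1) by positivity)
  set ρ : EuclideanSpace ℝ (Fin N) → ℝ := (mollifier N n).normed volume
  have hρ : Continuous ρ := (mollifier N n).continuous_normed
  have hρc : HasCompactSupport ρ := (mollifier N n).hasCompactSupport_normed
  have hclose : ∀ i, ∫⁻ x, ‖(ρ ⋆[lsmul ℝ ℝ, volume] w i) x - w i x‖ₑ ≤ ENNReal.ofReal (δ / 3) := by
    intro i
    refine ((hw i).lintegral_enorm_convolution_sub_le hρ hρc (mollifier N n).nonneg_normed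
      (mollifier N n).integral_normed (mollifier N n).support_normed_eq.subset).trans ?_
    refine (mul_le_mul' le_rfl (hG1 i)).trans ?_
    rw [← ENNReal.ofReal_coe_nnreal, ← ENNReal.ofReal_mul (mollifier N n).rOut_pos.le]
    refine ENNReal.ofReal_le_ofReal ?_
    rw [lt_div_iff₀ (by positivity)] at hn
    have : 0 < 1 / ((n : ℝ) + 1) := by positivity
    change 1 / ((n : ℝ) + 1) * M₃ ≤ δ / 3
    linarith
  have hwi : ∀ i, Integrable (w i) := fun i =>
    ⟨(hw i).1.aestronglyMeasurable, (hw1 i).trans_lt ENNReal.coe_lt_top⟩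
  have hwn : ∀ i, ∫ x, ‖w i x‖ ≤ M₁ := fun i => by
    rw [integral_norm_eq_lintegral_enorm (hwi i).1]
    exact ENNReal.toReal_le_coe_of_le_coe (hw1 i)
  set B' := closedBall (0 : EuclideanSpace ℝ (Fin N)) R
  have hB' : IsCompact B' := isCompact_closedBall _ _
  obtain ⟨t, ht, hcov⟩ := exists_finite_net_convolution hρ hρc hwi hwn hB'
    (show 0 < δ / 3 / (volume.real B' + 1) by positivity)
  refine ⟨t, ht, fun i => ?_⟩
  obtain ⟨j, hj, hij⟩ := hcov i
  refine ⟨j, hj, ?_⟩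
  set v : ι → EuclideanSpace ℝ (Fin N) → ℝ := fun i => ρ ⋆[lsmul ℝ ℝ, volume] w i
  have hvm : ∀ i, AEStronglyMeasurable (v i) (volume.restrict B') := fun i =>
    (continuous_convolution_of_locallyIntegrable hρ hρc (hw i).1).aestronglyMeasurable
  have hwm : ∀ i, AEStronglyMeasurable (w i) (volume.restrict B') := fun i => (hwi i).1.restrict
  have hmid : ∫⁻ x in B', ‖v i x - v j x‖ₑ ≤ ENNReal.ofReal (δ / 3) := by
    calc ∫⁻ x in B', ‖v i x - v j x‖ₑ
        ≤ ∫⁻ x in B', ENNReal.ofReal (δ / 3 / (volume.real B' + 1)) := by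
          refine setLIntegral_mono' hB'.measurableSet fun x hx => ?_
          rw [← ofReal_norm, ← dist_eq_norm]
          exact ENNReal.ofReal_le_ofReal (hij x hx).le
      _ = ENNReal.ofReal (δ / 3 / (volume.real B' + 1)) * ENNReal.ofReal (volume.real B') := by
          rw [setLIntegral_const, Measure.real, ENNReal.ofReal_toReal hB'.measure_lt_top.ne]
      _ ≤ ENNReal.ofReal (δ / 3) := by
          rw [← ENNReal.ofReal_mul (by positivity)]
          refine ENNReal.ofReal_le_ofReal ?_
          rw [div_mul_eq_mul_div, div_le_iff₀ (by positivity)]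
          nlinarith
  calc ∫⁻ x in B', ‖u i x - u j x‖ₑ
      ≤ ∫⁻ x in B', (‖v i x - w i x‖ₑ + (‖v i x - v j x‖ₑ + ‖v j x - w j x‖ₑ)) := by
        refine setLIntegral_mono' hB'.measurableSet fun x hx => ?_
        -- On the smaller ball the cutoff is 1, so u and w agree there.
        have e : u i x - u j x = -(v i x - w i x) + ((v i x - v j x) + (v j x - w j x)) := by
          simp only [w, hone x hx]; ring
        rw [e]
        refine (enorm_add_le _ _).trans (add_le_add (by rw [enorm_neg]) (enorm_add_le _ _))
    _ = (∫⁻ x in B', ‖v i x - w i x‖ₑ) + ((∫⁻ x in B', ‖v i x - v j x‖ₑ) +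
          ∫⁻ x in B', ‖v j x - w j x‖ₑ) := by
        have e1 : AEMeasurable (fun x => ‖v i x - w i x‖ₑ) (volume.restrict B') :=
          ((hvm i).sub (hwm i)).enorm
        have e2 : AEMeasurable (fun x => ‖v i x - v j x‖ₑ) (volume.restrict B') :=
          ((hvm i).sub (hvm j)).enorm
        rw [lintegral_add_left' e1, lintegral_add_left' e2]
    _ ≤ ENNReal.ofReal (δ / 3) + (ENNReal.ofReal (δ / 3) + ENNReal.ofReal (δ / 3)) :=
        add_le_add ((setLIntegral_le_lintegral _ _).trans (hclose i))
          (add_le_add hmid ((setLIntegral_le_lintegral _ _).trans (hclose j)))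
    _ = ENNReal.ofReal δ := by
        rw [← ENNReal.ofReal_add (by positivity) (by positivity),
          ← ENNReal.ofReal_add (by positivity) (by positivity)]
        congr 1; ring

/-! ### Hölder interpolation with weights -/

/-- Hölder's inequality written with weights summing to one, so that zero weights are allowed: they
occur at both endpoints β = 0 and β = r/(q-r). -/
theorem lintegral_mul_mul_rpow_le {α : Type*} [MeasurableSpace α] {μ : Measure α}
    {f g h : α → ℝ≥0∞} (hf : AEMeasurable f μ) (hg : AEMeasurable g μ) (hh : AEMeasurable h μ)
    {a b c : ℝ} (ha : 0 ≤ a) (hb : 0 ≤ b) (hc : 0 ≤ c) (habc : a + b + c = 1) :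
    ∫⁻ x, f x ^ a * g x ^ b * h x ^ c ∂μ ≤
      (∫⁻ x, f x ∂μ) ^ a * (∫⁻ x, g x ∂μ) ^ b * (∫⁻ x, h x ∂μ) ^ c := by
  have := ENNReal.lintegral_prod_norm_pow_le (μ := μ) Finset.univ (f := ![f, g, h])
    (p := ![a, b, c]) (by intro i _; fin_cases i <;> assumption)
    (by simpa [Fin.sum_univ_three] using habc) (by intro i _; fin_cases i <;> assumption)
  simpa [Fin.prod_univ_three] using this

/-- Hölder's inequality interpolating `∫ K|u|^r` between `∫ |u|^s` and `∫ V|u|^q`. -/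
theorem lintegral_weight_mul_rpow_le {α : Type*} [MeasurableSpace α] {μ : Measure α}
    {K V : α → ℝ} (hK : AEMeasurable K μ) (hV : AEMeasurable V μ) (hK0 : ∀ x, 0 < K x)
    (hV0 : ∀ x, 0 < V x) {u : α → ℝ} (hu : AEStronglyMeasurable u μ) {A β t b s q r : ℝ}
    (ht : 0 ≤ t) (hb : 0 ≤ b) (hβ : 0 ≤ β) (hs : 0 ≤ s) (hq : 0 ≤ q) (hsum : t + b + β * t = 1)
    (hA : A * t = 1) (hr : s * b + q * (β * t) = r) :
    ∫⁻ x, ENNReal.ofReal (K x) * ‖u x‖ₑ ^ r ∂μ ≤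
      (∫⁻ x, ENNReal.ofReal (K x ^ A * V x ^ (-β)) ∂μ) ^ t * (∫⁻ x, ‖u x‖ₑ ^ s ∂μ) ^ b *
        (∫⁻ x, ENNReal.ofReal (V x) * ‖u x‖ₑ ^ q ∂μ) ^ (β * t) := by
  have hβt : 0 ≤ β * t := by positivity
  refine le_trans (lintegral_mono fun x => le_of_eq ?_) (lintegral_mul_mul_rpow_le
    (((hK.pow_const A).mul (hV.pow_const (-β))).ennreal_ofReal) (hu.enorm.pow_const s)
    (hV.ennreal_ofReal.mul (hu.enorm.pow_const q)) ht hb hβt hsum)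
  -- The powers of V cancel and A * t = 1, so K itself is recovered from two of the three Hölder
  -- factors.
  have e : ENNReal.ofReal (K x ^ A * V x ^ (-β)) ^ t * ENNReal.ofReal (V x) ^ (β * t) =
      ENNReal.ofReal (K x) := by
    have h1 := hK0 x
    have h2 := hV0 x
    rw [ENNReal.ofReal_rpow_of_nonneg (by positivity) ht, ENNReal.ofReal_rpow_of_nonneg h2.le hβt,
      ← ENNReal.ofReal_mul (by positivity), Real.mul_rpow (by positivity) (by positivity),
      ← Real.rpow_mul h1.le, ← Real.rpow_mul h2.le, hA, Real.rpow_one, mul_assoc,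
      ← Real.rpow_add h2, neg_mul, neg_add_cancel, Real.rpow_zero, mul_one]
  simp only [Pi.mul_apply]
  rw [ENNReal.mul_rpow_of_nonneg _ _ hβt, ← ENNReal.rpow_mul, ← ENNReal.rpow_mul, ← hr,
    ENNReal.rpow_add_of_nonneg _ _ (by positivity) (by positivity), ← e]
  ring

/-- The strict bound on the exponent of K leaves room: 1/s + r/m < 1 for some finite s below it, and
the surplus becomes a positive power `b` of the L^1 norm. Hence L^1 smallness together with an L^m
bound forces smallness in L^r_K. -/
theorem exists_setLIntegral_weight_mul_rpow_le {α : Type*} [MeasurableSpace α] {μ : Measure α}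
    {B : Set α} (hB : μ B ≠ ⊤) {m r : ℝ} (hr : 1 ≤ r) (hrm : r < m) {a : ℝ≥0∞}
    (ha : ENNReal.ofReal (m / (m - r)) < a) {K : α → ℝ} (hK0 : ∀ x, 0 < K x)
    (hK : MemLp K a (μ.restrict B)) :
    ∃ D : ℝ≥0∞, D ≠ ⊤ ∧ ∃ b : ℝ, 0 < b ∧ ∃ c : ℝ, 0 ≤ c ∧
      ∀ w : α → ℝ, AEStronglyMeasurable w μ →
        ∫⁻ x in B, ENNReal.ofReal (K x) * ‖w x‖ₑ ^ r ∂μ ≤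
          D * (∫⁻ x in B, ‖w x‖ₑ ∂μ) ^ b * (∫⁻ x in B, ‖w x‖ₑ ^ m ∂μ) ^ c := by
  have : IsFiniteMeasure (μ.restrict B) := ⟨by
    rw [Measure.restrict_apply_univ]; exact hB.lt_top⟩
  obtain ⟨s, hs, hsa⟩ := ENNReal.lt_iff_exists_nnreal_btwn.1 ha
  have hKs : MemLp K s (μ.restrict B) := hK.mono_exponent hsa.le
  have hmr : 0 < m - r := by linarith
  have hm1 : 1 < m := by linarith
  have hms : m / (m - r) < s := by
    rw [← ENNReal.ofReal_coe_nnreal, ENNReal.ofReal_lt_ofReal_iff'] at hs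
    exact hs.1
  have hs0 : (0 : ℝ) < s := lt_trans (by positivity) hms
  have hs0' : (s : ℝ≥0∞) ≠ 0 := by
    rw [Ne, ENNReal.coe_eq_zero]; rintro rfl; simp at hs0
  have hsinv : (s : ℝ)⁻¹ < 1 - r / m := by
    rw [div_lt_iff₀ hmr] at hms
    rw [inv_lt_iff_one_lt_mul₀ hs0,
      show (1 - r / m) * (s : ℝ) = s * (m - r) / m by field_simp, lt_div_iff₀ (by linarith)]
    linarith
  -- The pair b, c solves 1/s + b + c = 1 and b + m c = r; positivity of b is the strict inequality
  -- `hsinv`.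
  set b : ℝ := (1 - (s : ℝ)⁻¹ - r / m) / (1 - 1 / m) with hb
  have h1m : 0 < 1 - 1 / m := by
    rw [sub_pos, div_lt_one (by linarith)]; exact hm1
  have hb0 : 0 < b := div_pos (by linarith) h1m
  have hbeq : b * (1 - 1 / m) = 1 - (s : ℝ)⁻¹ - r / m := div_mul_cancel₀ _ h1m.ne'
  have hbr : b ≤ r := by
    rw [hb, div_le_iff₀ h1m, mul_sub, mul_one_div]
    have : 0 < (s : ℝ)⁻¹ := by positivity
    linarith
  set c : ℝ := (r - b) / m with hc
  have hc0 : 0 ≤ c := div_nonneg (by linarith) (by linarith)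
  have hcs : c * s * (s : ℝ)⁻¹ = c := by field_simp
  refine ⟨(∫⁻ x in B, ENNReal.ofReal (K x ^ (s : ℝ) * 1 ^ (-(c * s))) ∂μ) ^ (s : ℝ)⁻¹,
    ENNReal.rpow_ne_top_of_nonneg (by positivity) ?_, b, hb0, c, hc0, fun w hw => ?_⟩
  · have := lintegral_rpow_enorm_lt_top_of_eLpNorm_lt_top hs0' ENNReal.coe_ne_top hKs.2
    refine ne_of_eq_of_ne ?_ this.ne
    refine lintegral_congr fun x => ?_
    rw [Real.one_rpow, mul_one, Real.enorm_of_nonneg (hK0 x).le, ENNReal.coe_toReal,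
      ENNReal.ofReal_rpow_of_pos (hK0 x)]
  -- The trivial weight V = 1 with β = c s and t = 1/s turns the exponent β t into c.
  · have := lintegral_weight_mul_rpow_le (K := K) (V := fun _ => 1) (μ := μ.restrict B)
      hKs.1.aemeasurable aemeasurable_const hK0 (fun _ => one_pos) hw.restrict
      (A := s) (β := c * s) (t := (s : ℝ)⁻¹) (b := b) (s := 1) (q := m) (r := r)
      (by positivity) hb0.le (by positivity) zero_le_one (by linarith)
      (by rw [hcs, hc, sub_div]; rw [mul_sub, mul_one_div] at hbeq; linarith)
      (mul_inv_cancel₀ hs0.ne') (by rw [hcs, hc]; field_simp; ring)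
    simpa only [hcs, ENNReal.rpow_one, ENNReal.ofReal_one, one_mul] using this

/-! ### Weighted norms and completeness of L^s-bounded sets -/

theorem eLpNorm_weightMeasure_rpow {N : ℕ} {W : EuclideanSpace ℝ (Fin N) → ℝ}
    (hW : AEMeasurable W volume) {u : EuclideanSpace ℝ (Fin N) → ℝ}
    (hu : AEStronglyMeasurable u volume) {s : ℝ} (hs : 0 < s) :
    eLpNorm u (ENNReal.ofReal s) (weightMeasure W) ^ s =
      ∫⁻ x, ENNReal.ofReal (W x) * ‖u x‖ₑ ^ s := by
  rw [eLpNorm_eq_lintegral_rpow_enorm_toReal (by simpa using hs) ENNReal.ofReal_ne_top,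
    ENNReal.toReal_ofReal hs.le, ← ENNReal.rpow_mul, one_div_mul_cancel hs.ne', ENNReal.rpow_one,
    weightMeasure, lintegral_withDensity_eq_lintegral_mul₀ hW.ennreal_ofReal (hu.enorm.pow_const s)]
  rfl

theorem eLpNorm_ofReal_rpow {α F : Type*} [MeasurableSpace α] [NormedAddCommGroup F]
    {μ : Measure α} (u : α → F) {s : ℝ} (hs : 0 < s) :
    eLpNorm u (ENNReal.ofReal s) μ ^ s = ∫⁻ x, ‖u x‖ₑ ^ s ∂μ := by
  rw [eLpNorm_eq_lintegral_rpow_enorm_toReal (by simpa using hs) ENNReal.ofReal_ne_top,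
    ENNReal.toReal_ofReal hs.le, ← ENNReal.rpow_mul, one_div_mul_cancel hs.ne', ENNReal.rpow_one]

theorem volume_ac_weightMeasure {N : ℕ} {W : EuclideanSpace ℝ (Fin N) → ℝ}
    (hW : AEMeasurable W volume) (hW0 : ∀ x, 0 < W x) : volume ≪ weightMeasure W :=
  withDensity_absolutelyContinuous' hW.ennreal_ofReal
    (Eventually.of_forall fun x => by simpa using hW0 x)

/-- Bounded sets of `L^s` are complete for the norm of `L^r_K`. -/
theorem weightedLp.isComplete_setOf_eLpNorm_le {N : ℕ} {r s : ℝ} [hr : Fact (1 ≤ r)] (hs : 1 ≤ s)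
    {K : EuclideanSpace ℝ (Fin N) → ℝ} (hK : AEMeasurable K volume) (hK0 : ∀ x, 0 < K x)
    (C : ℝ≥0) :
    IsComplete {f : weightedLp r K |
      eLpNorm (f : EuclideanSpace ℝ (Fin N) →ₘ[volume] ℝ) (ENNReal.ofReal s) volume ≤ C} := by
  rw [← completeSpace_coe_iff_isComplete]
  refine Metric.complete_of_convergent_controlled_sequences (fun n => (1 / 2 : ℝ) ^ n)
    (fun n => by positivity) fun v hv => ?_
  have hdist : ∀ f g : weightedLp r K, ENNReal.ofReal (dist f g) =
      eLpNorm ((f : EuclideanSpace ℝ (Fin N) →ₘ[volume] ℝ) - g : EuclideanSpace ℝ (Fin N) → ℝ)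
        (ENNReal.ofReal r) (weightMeasure K) := by
    intro f g
    rw [dist_eq_norm]
    have h1 : ‖f - g‖ = (eLpNorm ((f - g : weightedLp r K) : EuclideanSpace ℝ (Fin N) →ₘ[volume] ℝ)
      (ENNReal.ofReal r) (weightMeasure K)).toReal := rfl
    rw [h1, ENNReal.ofReal_toReal (f - g).2.2.2.ne]
    exact eLpNorm_congr_ae ((weightMeasure_ac K).ae_le (AEEqFun.coeFn_sub _ _))
  have hmem : ∀ n, MemLp ((v n : weightedLp r K) : EuclideanSpace ℝ (Fin N) →ₘ[volume] ℝ)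
      (ENNReal.ofReal r) (weightMeasure K) := fun n => (v n).1.2.2
  obtain ⟨f, hf, hlim⟩ := Lp.cauchy_complete_eLpNorm (by simpa using hr.out) hmem
    (B := fun n => ENNReal.ofReal ((1 / 2 : ℝ) ^ n))
    (by
      rw [← ENNReal.ofReal_tsum_of_nonneg (fun n => by positivity) summable_geometric_two]
      exact ENNReal.ofReal_ne_top)
    (fun k n m hn hm => by
      rw [← hdist]
      exact (ENNReal.ofReal_lt_ofReal_iff (by positivity)).2 (hv k n m hn hm))
  have hac := volume_ac_weightMeasure hK hK0
  have hfm : AEStronglyMeasurable f volume := hf.1.mono_ac hac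
  obtain ⟨ns, -, hns⟩ := (tendstoInMeasure_of_tendsto_eLpNorm
    (by simpa using zero_lt_one.trans_le hr.out) (fun n => (hmem n).1) hf.1
    hlim).exists_seq_tendsto_ae
  -- Fatou along an a.e. convergent subsequence preserves the L^s bound. This bound makes the limit
  -- locally integrable, which convergence for the weight K alone does not supply.
  have hfC : eLpNorm f (ENNReal.ofReal s) volume ≤ C := by
    refine (Lp.eLpNorm_lim_le_liminf_eLpNorm (fun n => (v (ns n)).1.1.aestronglyMeasurable) f
      (hac.ae_le hns)).trans ?_
    exact (liminf_le_liminf (v := fun _ => (C : ℝ≥0∞)) (Eventually.of_forall fun n =>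
      (v (ns n)).2)).trans_eq tendsto_const_nhds.liminf_eq
  have hae := AEEqFun.coeFn_mk f hfm
  let F : weightedLp r K := ⟨AEEqFun.mk f hfm,
    locallyIntegrable_congr hae.symm (MemLp.locallyIntegrable
      ⟨hfm, hfC.trans_lt ENNReal.coe_lt_top⟩ (by simpa using hs)),
    (memLp_congr_ae ((weightMeasure_ac K).ae_le hae)).2 hf⟩
  refine ⟨⟨F, (eLpNorm_congr_ae hae).trans_le hfC⟩, ?_⟩
  rw [tendsto_subtype_rng, tendsto_iff_dist_tendsto_zero]
  have h2 := (ENNReal.tendsto_toReal ENNReal.zero_ne_top).comp hlim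
  rw [ENNReal.toReal_zero] at h2
  refine h2.congr fun n => ?_
  rw [Function.comp_apply, ← ENNReal.toReal_ofReal (dist_nonneg (x := (v n : weightedLp r K))
    (y := F)), hdist]
  congr 1
  refine eLpNorm_congr_ae ?_
  filter_upwards [(weightMeasure_ac K).ae_le hae] with x hx
  simp only [Pi.sub_apply, F, hx]

/-! ### Uniform estimates on bounded sets of M^{1,p,q}_V -/

/-- The exponents of the weighted interpolation inequality. -/
theorem interpolation_exponents {s q r β : ℝ} (hrs : r < s) (hrq : r < q)
    (hβ₀ : 0 ≤ β) (hβ₁ : β ≤ r / (q - r)) :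
    ∃ t > 0, ∃ b ≥ 0, t + b + β * t = 1 ∧ (s + β * (s - q)) / (s - r) * t = 1 ∧
      s * b + q * (β * t) = r := by
  rw [le_div_iff₀ (by linarith)] at hβ₁
  have hsr : 0 < s - r := by linarith
  -- When q > s, β(q - s) ≤ β(q - r) ≤ r < s.
  have hD : 0 < s + β * (s - q) := by nlinarith
  -- The first two equations determine t and b, and the third then holds identically; the upper
  -- bound on β says exactly b ≥ 0.
  refine ⟨(s - r) / (s + β * (s - q)), by positivity,
    (r - β * (q - r)) / (s + β * (s - q)), div_nonneg (by linarith) hD.le, ?_, ?_, ?_⟩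
  · field_simp; ring
  · field_simp
  · field_simp; ring

theorem sobolevM.eLpNorm_grad_le {N : ℕ} {p q : ℝ} {V : EuclideanSpace ℝ (Fin N) → ℝ}
    (w : sobolevM p q V) :
    eLpNorm (sobolevM.grad w) (ENNReal.ofReal p) volume ≤ ENNReal.ofReal ‖w‖ := by
  rw [← ENNReal.ofReal_toReal (sobolevM.memLp_grad w).2.ne]
  exact ENNReal.ofReal_le_ofReal (le_add_of_nonneg_left ENNReal.toReal_nonneg)

theorem sobolevM.eLpNorm_weight_le {N : ℕ} {p q : ℝ} {V : EuclideanSpace ℝ (Fin N) → ℝ}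
    (w : sobolevM p q V) :
    eLpNorm (w : EuclideanSpace ℝ (Fin N) →ₘ[volume] ℝ) (ENNReal.ofReal q) (weightMeasure V) ≤
      ENNReal.ofReal ‖w‖ := by
  rw [← ENNReal.ofReal_toReal w.2.2.2.2.ne]
  exact ENNReal.ofReal_le_ofReal (le_add_of_nonneg_right ENNReal.toReal_nonneg)

section

variable {N : ℕ} {p q : ℝ} [hp : Fact (1 ≤ p)] [hq : Fact (1 ≤ q)]
  {V : EuclideanSpace ℝ (Fin N) → ℝ}

theorem sobolevM.exists_eLpNorm_sobolevConj_le (hpN : p < N) : ∃ C : ℝ≥0,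
    ∀ w : sobolevM p q V, eLpNorm (w : EuclideanSpace ℝ (Fin N) →ₘ[volume] ℝ)
      (ENNReal.ofReal (sobolevConj N p)) volume ≤ C * ENNReal.ofReal ‖w‖ :=
  ⟨_, fun w => ((sobolevM.isWeakGradient_grad w).eLpNorm_sobolevConj_le hp.out hpN w.2.1.1).trans
    (mul_le_mul' le_rfl (sobolevM.eLpNorm_grad_le w))⟩

/-- On each measurable set `S`, the weighted `L^r_K` integral over `S` is controlled on bounded
sets of `M^{1,p,q}_V` by a power of the integral over `S` of the weight in the hypothesis. -/
theorem sobolevM.exists_setLIntegral_weight_le {r β : ℝ} (hr : 1 ≤ r) (hpN : p < N)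
    (hrm : r < min (sobolevConj N p) q) {K : EuclideanSpace ℝ (Fin N) → ℝ}
    (hKm : AEMeasurable K volume) (hVm : AEMeasurable V volume)
    (hKpos : ∀ x, 0 < K x) (hVpos : ∀ x, 0 < V x) (hβ₀ : 0 ≤ β) (hβ₁ : β ≤ r / (q - r)) (ρ : ℝ) :
    ∃ t : ℝ, 0 < t ∧ ∃ D : ℝ≥0∞, D ≠ ⊤ ∧ ∀ w : sobolevM p q V, ‖w‖ ≤ ρ →
      ∀ S : Set (EuclideanSpace ℝ (Fin N)),
      ∫⁻ x in S, ENNReal.ofReal (K x) *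
        ‖(w : EuclideanSpace ℝ (Fin N) →ₘ[volume] ℝ) x‖ₑ ^ r ≤
      (∫⁻ x in S, ENNReal.ofReal (K x ^ ((sobolevConj N p + β * (sobolevConj N p - q)) /
        (sobolevConj N p - r)) * V x ^ (-β))) ^ t * D := by
  obtain ⟨C, hC⟩ := sobolevM.exists_eLpNorm_sobolevConj_le (V := V) (q := q) hpN
  obtain ⟨hr1, hr2⟩ := lt_min_iff.1 hrm
  have hs0 : 0 < sobolevConj N p := by linarith
  have hq0 : 0 < q := by linarith
  obtain ⟨t, ht, b, hb, h1, h2, h3⟩ := interpolation_exponents hr1 hr2 hβ₀ hβ₁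
  refine ⟨t, ht, ((C * ENNReal.ofReal ρ) ^ sobolevConj N p) ^ b *
    (ENNReal.ofReal ρ ^ q) ^ (β * t), ?_, fun w hw S => ?_⟩
  · have : 0 ≤ β * t := by positivity
    finiteness
  · have hum := (w : EuclideanSpace ℝ (Fin N) →ₘ[volume] ℝ).aestronglyMeasurable
    refine (lintegral_weight_mul_rpow_le hKm.restrict hVm.restrict hKpos hVpos hum.restrict ht.le hb
      hβ₀ hs0.le hq0.le h1 h2 h3).trans ?_
    rw [mul_assoc]
    have hwρ := ENNReal.ofReal_le_ofReal hw
    gcongr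
    · refine (setLIntegral_le_lintegral _ _).trans ?_
      rw [← eLpNorm_ofReal_rpow _ hs0]
      exact ENNReal.rpow_le_rpow ((hC w).trans (mul_le_mul' le_rfl hwρ)) hs0.le
    · refine (setLIntegral_le_lintegral _ _).trans ?_
      rw [← eLpNorm_weightMeasure_rpow hVm hum hq0]
      exact ENNReal.rpow_le_rpow ((sobolevM.eLpNorm_weight_le w).trans hwρ) hq0.le

/-- If the maximum is p*, this is Sobolev's inequality; if it is q, the lower bound of V on B
removes the weight. The larger exponent is the one in the integrability condition on K. -/
theorem sobolevM.exists_setLIntegral_rpow_max_le (hpN : p < N)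
    (hVm : AEMeasurable V volume) {B : Set (EuclideanSpace ℝ (Fin N))} (hB : MeasurableSet B)
    {c : ℝ} (hc : 0 < c) (hcV : ∀ x ∈ B, c ≤ V x) (ρ : ℝ) :
    ∃ D : ℝ≥0∞, D ≠ ⊤ ∧ ∀ w : sobolevM p q V, ‖w‖ ≤ ρ →
      ∫⁻ x in B, ‖(w : EuclideanSpace ℝ (Fin N) →ₘ[volume] ℝ) x‖ₑ ^ max (sobolevConj N p) q ≤
        D := by
  obtain ⟨C, hC⟩ := sobolevM.exists_eLpNorm_sobolevConj_le (V := V) (q := q) hpN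
  have hs0 : 0 < sobolevConj N p := by linarith [lt_sobolevConj hp.out hpN, hp.out]
  have hq0 : 0 < q := by linarith [hq.out]
  rcases max_choice (sobolevConj N p) q with h | h <;> rw [h]
  · refine ⟨(C * ENNReal.ofReal ρ) ^ sobolevConj N p, by finiteness, fun w hw => ?_⟩
    refine (setLIntegral_le_lintegral _ _).trans ?_
    rw [← eLpNorm_ofReal_rpow _ hs0]
    exact ENNReal.rpow_le_rpow ((hC w).trans (mul_le_mul' le_rfl (ENNReal.ofReal_le_ofReal hw)))
      hs0.le
  · refine ⟨ENNReal.ofReal c⁻¹ * ENNReal.ofReal ρ ^ q, by finiteness, fun w hw => ?_⟩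
    have hum := (w : EuclideanSpace ℝ (Fin N) →ₘ[volume] ℝ).aestronglyMeasurable
    calc ∫⁻ x in B, ‖(w : EuclideanSpace ℝ (Fin N) →ₘ[volume] ℝ) x‖ₑ ^ q
        ≤ ∫⁻ x in B, ENNReal.ofReal c⁻¹ * (ENNReal.ofReal (V x) *
            ‖(w : EuclideanSpace ℝ (Fin N) →ₘ[volume] ℝ) x‖ₑ ^ q) := by
          refine setLIntegral_mono' hB fun x hx => ?_
          rw [← mul_assoc, ← ENNReal.ofReal_mul (by positivity)]
          refine le_mul_of_one_le_left' ?_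
          rw [ENNReal.one_le_ofReal, inv_mul_eq_div, one_le_div hc]
          exact hcV x hx
      _ ≤ ENNReal.ofReal c⁻¹ * ∫⁻ x, ENNReal.ofReal (V x) *
            ‖(w : EuclideanSpace ℝ (Fin N) →ₘ[volume] ℝ) x‖ₑ ^ q := by
          rw [lintegral_const_mul' _ _ ENNReal.ofReal_ne_top]
          exact mul_le_mul' le_rfl (setLIntegral_le_lintegral _ _)
      _ ≤ _ := by
          rw [← eLpNorm_weightMeasure_rpow hVm hum hq0]
          exact mul_le_mul' le_rfl (ENNReal.rpow_le_rpow ((sobolevM.eLpNorm_weight_le w).trans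
            (ENNReal.ofReal_le_ofReal hw)) hq0.le)

/-- The unit ball of `M^{1,p,q}_V` has finite nets for the norm of `L^r_K`. -/
theorem sobolevM.exists_finite_net {r β : ℝ} {α : ℝ≥0∞} (hr : 1 ≤ r) (hpN : p < N)
    (hrm : r < min (sobolevConj N p) q) {K : EuclideanSpace ℝ (Fin N) → ℝ}
    (hKm : AEMeasurable K volume) (hVm : AEMeasurable V volume)
    (hKpos : ∀ x, 0 < K x) (hVpos : ∀ x, 0 < V x)
    (hα : ENNReal.ofReal (max (sobolevConj N p) q / (max (sobolevConj N p) q - r)) < α)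
    (hKloc : ∀ D : Set (EuclideanSpace ℝ (Fin N)), IsCompact D → MemLp K α (volume.restrict D))
    (hVloc : ∀ D : Set (EuclideanSpace ℝ (Fin N)), IsCompact D → ∃ c > 0, ∀ x ∈ D, c ≤ V x)
    (hβ₀ : 0 ≤ β) (hβ₁ : β ≤ r / (q - r))
    (hKV : ∫⁻ x, ENNReal.ofReal (K x ^ ((sobolevConj N p + β * (sobolevConj N p - q)) /
        (sobolevConj N p - r)) * V x ^ (-β)) ≠ ⊤) {ε : ℝ} (hε : 0 < ε) :
    ∃ t : Set (ball (0 : sobolevM p q V) 1), t.Finite ∧ ∀ u : ball (0 : sobolevM p q V) 1,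
      ∃ v ∈ t, eLpNorm ((u : sobolevM p q V) - (v : sobolevM p q V) : sobolevM p q V).1
        (ENNReal.ofReal r) (weightMeasure K) < ENNReal.ofReal ε := by
  have hr0 : 0 < r := by linarith
  obtain ⟨C, hC⟩ := sobolevM.exists_eLpNorm_sobolevConj_le (V := V) (q := q) hpN
  have hps := lt_sobolevConj hp.out hpN
  -- Ball and exterior each contribute at most η, and a third rather than a half makes the total
  -- strictly less than ε^r. The bounds below are for norm at most 2 because they are applied to
  -- differences of points of the unit ball.
  set η : ℝ≥0∞ := ENNReal.ofReal (ε ^ r / 3) with hη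
  have hη0 : 0 < η := ENNReal.ofReal_pos.2 (by positivity)
  obtain ⟨n, hn, htail⟩ : ∃ n : ℕ, 0 < n ∧ ∀ w : sobolevM p q V, ‖w‖ ≤ 2 →
      ∫⁻ x in (ball 0 (n : ℝ))ᶜ, ENNReal.ofReal (K x) *
        ‖(w : EuclideanSpace ℝ (Fin N) →ₘ[volume] ℝ) x‖ₑ ^ r ≤ η := by
    obtain ⟨t, ht, D, hD, H⟩ := sobolevM.exists_setLIntegral_weight_le (V := V) hr hpN hrm hKm hVm
      hKpos hVpos hβ₀ hβ₁ 2
    have hl := ENNReal.Tendsto.mul_const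
      ((tendsto_setLIntegral_compl_ball hKV).ennrpow_const t) (Or.inr hD)
    rw [ENNReal.zero_rpow_of_pos ht, zero_mul] at hl
    obtain ⟨n, hn, hn0⟩ := ((hl.eventually_le_const hη0).and (eventually_gt_atTop 0)).exists
    exact ⟨n, hn0, fun w hw => (H w hw _).trans hn⟩
  obtain ⟨δ, hδ, hloc⟩ : ∃ δ : ℝ, 0 < δ ∧ ∀ w : sobolevM p q V, ‖w‖ ≤ 2 →
      ∫⁻ x in closedBall 0 (n : ℝ), ‖(w : EuclideanSpace ℝ (Fin N) →ₘ[volume] ℝ) x‖ₑ ≤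
        ENNReal.ofReal δ →
      ∫⁻ x in closedBall 0 (n : ℝ), ENNReal.ofReal (K x) *
        ‖(w : EuclideanSpace ℝ (Fin N) →ₘ[volume] ℝ) x‖ₑ ^ r ≤ η := by
    set B := closedBall (0 : EuclideanSpace ℝ (Fin N)) (n : ℝ)
    have hB : IsCompact B := isCompact_closedBall _ _
    obtain ⟨c, hc, hcV⟩ := hVloc B hB
    obtain ⟨M, hM, HM⟩ := sobolevM.exists_setLIntegral_rpow_max_le (q := q) hpN hVm
      hB.measurableSet hc hcV 2
    obtain ⟨D, hD, b, hb, e, he, HD⟩ := exists_setLIntegral_weight_mul_rpow_le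
      hB.measure_lt_top.ne hr (hrm.trans_le (min_le_max)) hα hKpos (hKloc B hB)
    have hl : Tendsto (fun δ : ℝ => D * ENNReal.ofReal δ ^ b * M ^ e) (𝓝[>] 0) (𝓝 0) := by
      have h1 : Tendsto (fun δ : ℝ => ENNReal.ofReal δ) (𝓝[>] 0) (𝓝 0) := by
        have := (ENNReal.tendsto_ofReal (tendsto_id (α := ℝ) (x := 𝓝 0)))
        rw [ENNReal.ofReal_zero] at this
        exact this.mono_left nhdsWithin_le_nhds
      have h2 := ENNReal.Tendsto.mul_const (b := M ^ e) (ENNReal.Tendsto.const_mul (a := D)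
        (h1.ennrpow_const b) (Or.inr hD)) (Or.inr (ENNReal.rpow_ne_top_of_nonneg he hM))
      rwa [ENNReal.zero_rpow_of_pos hb, mul_zero, zero_mul] at h2
    obtain ⟨δ, hδ, hδ0⟩ := ((hl.eventually_le_const hη0).and self_mem_nhdsWithin).exists
    refine ⟨δ, hδ0, fun w hw hwδ => (HD _ w.1.aestronglyMeasurable).trans (le_trans ?_ hδ)⟩
    gcongr
    exact HM w hw
  -- The constant C + 1 dominates both bounds on the unit ball: C for the L^(p*) norm and 1 for the
  -- gradient.
  obtain ⟨t, ht, H⟩ := exists_finite_net_setLIntegral_ball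
    (ι := ball (0 : sobolevM p q V) 1)
    (u := fun u => ((u : sobolevM p q V) : EuclideanSpace ℝ (Fin N) →ₘ[volume] ℝ))
    (g := fun u => sobolevM.grad (u : sobolevM p q V))
    (fun u => sobolevM.isWeakGradient_grad _) (a := sobolevConj N p) (b := p)
    (by linarith [hp.out]) hp.out (M := C + 1)
    (fun u => by
      refine (hC u).trans ?_
      have : ENNReal.ofReal ‖(u : sobolevM p q V)‖ ≤ 1 :=
        ENNReal.ofReal_le_one.2 (mem_ball_zero_iff.1 u.2).le
      refine (mul_le_of_le_one_right' this).trans ?_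
      exact_mod_cast le_add_of_nonneg_right zero_le_one)
    (fun u => by
      refine (sobolevM.eLpNorm_grad_le _).trans ?_
      have : ENNReal.ofReal ‖(u : sobolevM p q V)‖ ≤ 1 :=
        ENNReal.ofReal_le_one.2 (mem_ball_zero_iff.1 u.2).le
      refine this.trans ?_
      exact_mod_cast le_add_of_nonneg_left (zero_le (a := C)))
    (R := n) (by exact_mod_cast hn) hδ
  refine ⟨t, ht, fun u => ?_⟩
  obtain ⟨v, hv, huv⟩ := H u
  refine ⟨v, hv, ?_⟩
  set w : sobolevM p q V := (u : sobolevM p q V) - (v : sobolevM p q V) with hw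
  have hw2 : ‖w‖ ≤ 2 := by
    have h1 := (mem_ball_zero_iff.1 u.2).le
    have h2 := (mem_ball_zero_iff.1 v.2).le
    exact (norm_sub_le _ _).trans (by linarith)
  have hwae : (w : EuclideanSpace ℝ (Fin N) →ₘ[volume] ℝ) =ᵐ[volume] fun x =>
      ((u : sobolevM p q V) : EuclideanSpace ℝ (Fin N) →ₘ[volume] ℝ) x -
      ((v : sobolevM p q V) : EuclideanSpace ℝ (Fin N) →ₘ[volume] ℝ) x :=
    AEEqFun.coeFn_sub _ _
  have hwδ : ∫⁻ x in closedBall 0 (n : ℝ), ‖(w : EuclideanSpace ℝ (Fin N) →ₘ[volume] ℝ) x‖ₑ ≤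
      ENNReal.ofReal δ := by
    refine le_trans (le_of_eq (lintegral_congr_ae (ae_restrict_of_ae ?_))) huv
    filter_upwards [hwae] with x hx
    rw [hx]
  rw [← ENNReal.rpow_lt_rpow_iff hr0, eLpNorm_weightMeasure_rpow hKm w.1.aestronglyMeasurable hr0]
  calc ∫⁻ x, ENNReal.ofReal (K x) * ‖(w : EuclideanSpace ℝ (Fin N) →ₘ[volume] ℝ) x‖ₑ ^ r
      ≤ (∫⁻ x in ball 0 (n : ℝ), ENNReal.ofReal (K x) *
          ‖(w : EuclideanSpace ℝ (Fin N) →ₘ[volume] ℝ) x‖ₑ ^ r) +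
        ∫⁻ x in (ball 0 (n : ℝ))ᶜ, ENNReal.ofReal (K x) *
          ‖(w : EuclideanSpace ℝ (Fin N) →ₘ[volume] ℝ) x‖ₑ ^ r :=
        (lintegral_add_compl _ measurableSet_ball).ge
    _ ≤ η + η := add_le_add ((lintegral_mono_set ball_subset_closedBall).trans (hloc w hw2 hwδ))
        (htail w hw2)
    _ < ENNReal.ofReal ε ^ r := by
        rw [hη, ← ENNReal.ofReal_add (by positivity) (by positivity),
          ENNReal.ofReal_rpow_of_pos hε, ENNReal.ofReal_lt_ofReal_iff (by positivity)]
        have : 0 < ε ^ r := by positivity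
        linarith

end

/-! ### The embedding and its compactness -/

theorem proposition2p3 {N : ℕ} {p q r β : ℝ} {α : ℝ≥0∞}
    [Fact (1 ≤ p)] [Fact (1 ≤ q)] [Fact (1 ≤ r)]
    (hpN : p < N) (hq : 1 < q) (hr : r < min (sobolevConj N p) q)
    (K V : EuclideanSpace ℝ (Fin N) → ℝ)
    (hKm : AEMeasurable K volume) (hVm : AEMeasurable V volume)
    (hKpos : ∀ x, 0 < K x) (hVpos : ∀ x, 0 < V x)
    (hα : ENNReal.ofReal (max (sobolevConj N p) q / (max (sobolevConj N p) q - r)) < α)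
    (hKloc : ∀ D : Set (EuclideanSpace ℝ (Fin N)), IsCompact D → MemLp K α (volume.restrict D))
    (hVloc : ∀ D : Set (EuclideanSpace ℝ (Fin N)), IsCompact D → ∃ c > 0, ∀ x ∈ D, c ≤ V x)
    (hβ₀ : 0 ≤ β) (hβ₁ : β ≤ r / (q - r))
    (hKV : Integrable (fun x =>
      K x ^ ((sobolevConj N p + β * (sobolevConj N p - q)) / (sobolevConj N p - r)) *
        V x ^ (-β)) volume) :
    ∃ h : sobolevM p q V ≤ weightedLp r K,
      Continuous (Submodule.inclusion h) ∧ IsCompactOperator (Submodule.inclusion h) := by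
  have hp1 : 1 ≤ p := Fact.out
  have hr1 : 1 ≤ r := Fact.out
  have hr0 : 0 < r := by linarith
  have hps := lt_sobolevConj hp1 hpN
  have hKV' : ∫⁻ x, ENNReal.ofReal (K x ^ ((sobolevConj N p + β * (sobolevConj N p - q)) /
      (sobolevConj N p - r)) * V x ^ (-β)) ≠ ⊤ := by
    refine ne_of_eq_of_ne (lintegral_congr fun x => ?_) hKV.2.ne
    have h1 := hKpos x
    have h2 := hVpos x
    rw [Real.enorm_of_nonneg (by positivity)]
  have h : sobolevM p q V ≤ weightedLp r K := by
    intro u hu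
    have hum := u.aestronglyMeasurable
    refine ⟨hu.2.1, aestronglyMeasurable_weight K u, ?_⟩
    obtain ⟨t, ht, D, hD, H⟩ := sobolevM.exists_setLIntegral_weight_le (V := V) hr1 hpN hr hKm hVm
      hKpos hVpos hβ₀ hβ₁ ‖(⟨u, hu⟩ : sobolevM p q V)‖
    -- The tail estimate over the whole space is the embedding.
    have hfin := H ⟨u, hu⟩ le_rfl univ
    rw [setLIntegral_univ, setLIntegral_univ, ← eLpNorm_weightMeasure_rpow hKm hum hr0] at hfin
    refine (ENNReal.rpow_lt_top_iff_of_pos hr0).1 (hfin.trans_lt ?_)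
    exact (ENNReal.mul_ne_top (ENNReal.rpow_ne_top_of_nonneg ht.le hKV') hD).lt_top
  have hcomp : IsCompactOperator (Submodule.inclusion h) := by
    obtain ⟨C, hC⟩ := sobolevM.exists_eLpNorm_sobolevConj_le (V := V) (q := q) hpN
    set S : Set (weightedLp r K) := {f |
      eLpNorm (f : EuclideanSpace ℝ (Fin N) →ₘ[volume] ℝ) (ENNReal.ofReal (sobolevConj N p))
        volume ≤ C}
    have hS : IsComplete S :=
      weightedLp.isComplete_setOf_eLpNorm_le (by linarith) hKm hKpos C
    set T : Set (weightedLp r K) := Submodule.inclusion h '' ball 0 1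
    have hTS : T ⊆ S := by
      rintro _ ⟨u, hu, rfl⟩
      refine (hC u).trans (mul_le_of_le_one_right' ?_)
      exact ENNReal.ofReal_le_one.2 (mem_ball_zero_iff.1 hu).le
    have hT : TotallyBounded T := by
      rw [Metric.totallyBounded_iff]
      intro ε hε
      obtain ⟨t, ht, H⟩ := sobolevM.exists_finite_net hr1 hpN hr hKm hVm hKpos hVpos hα hKloc hVloc
        hβ₀ hβ₁ hKV' hε
      refine ⟨(fun u : ball (0 : sobolevM p q V) 1 => Submodule.inclusion h u) '' t, ht.image _, ?_⟩
      rintro _ ⟨u, hu, rfl⟩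
      obtain ⟨v, hv, huv⟩ := H ⟨u, hu⟩
      refine mem_iUnion₂.2 ⟨_, mem_image_of_mem _ hv, ?_⟩
      rw [mem_ball, dist_eq_norm]
      exact (ENNReal.toReal_lt_of_lt_ofReal huv)
    -- Closedness of S is not needed: a Cauchy filter on the intersection converges within the
    -- complete set S, and its limit stays in the closure of T.
    refine ⟨S ∩ closure T, ?_, ?_⟩
    · rw [isCompact_iff_totallyBounded_isComplete]
      refine ⟨hT.closure.subset inter_subset_right, fun f hf hfS => ?_⟩
      obtain ⟨hfS, hfT⟩ := le_inf_iff.1 (inf_principal (α := weightedLp r K) ▸ hfS)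
      obtain ⟨x, hx, hfx⟩ := hS f hf hfS
      have := hf.1
      exact ⟨x, ⟨hx, isClosed_closure.mem_of_tendsto (f := id) (b := f) hfx
        (le_principal_iff.1 hfT)⟩, hfx⟩
    · filter_upwards [ball_mem_nhds (0 : sobolevM p q V) one_pos] with u hu
      exact ⟨hTS (mem_image_of_mem _ hu), subset_closure (mem_image_of_mem _ hu)⟩
  -- A compact linear map is bounded near zero, hence continuous.
  exact ⟨h, hcomp.continuous, hcomp⟩
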